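/- Let $n\ge 2$. For a pseudo-Riemannian metric $g_M$ on an $n$-dimensional smooth manifold $M$, let $\Delta_M=\operatorname{tr}_{g_M}\nabla d$ be the Laplace–Beltrami operator, let $K_M$ be the scalar curvature (the metric trace of the Ricci tensor of the Levi-Civita connection, normalized so that $K_{S^n}=n(n-1)$), and let $$\widetilde\Delta_M:=\Delta_M-\frac{n-2}{4(n-1)}K_M$$ be the Yamabe operator on the space $C^\infty(M)$ of smooth complex-valued functions. A local diffeomorphism $\Phi:M\to N$ between $n$-dimensional pseudo-Riemannian manifolds $(M,g_M)$, $(N,g_N)$ is called conformal if $\Phi^*g_N=\Omega^2g_M$ for a positive function $\Omega$ on $M$, its conformal factor. For $\lambda\in\mathbb C$ its twisted pull-back is $$\Phi_\lambda^*:C^\infty(N)\to C^\infty(M),\qquad f\mapsto\Omega^\lambda\,(f\circ\Phi),$$ and $\widetilde{\Phi^*}:=\Phi^*_{(n-2)/2}$. If a group $G$ acts on $M$ so that every $L_h:x\mapsto hx$ is conformal, with $L_h^*g_M=\Omega(h,\cdot)^2g_M$, let $\varpi_{M,\lambda}$ be the representation of $G$ on $C^\infty(M)$ given by $(\varpi_{M,\lambda}(h^{-1})f)(x)=\Omega(h,x)^\lambda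 f(hx)$, and put $\varpi_M:=\varpi_{M,(n-2)/2}$. **Proposition.** Let $(M,g_M)$ and $(N,g_N)$ be pseudo-Riemannian manifolds of dimension $n\ge 2$ and let $\Phi:M\to N$ be a conformal local diffeomorphism with conformal factor $\Omega$. Let groups $G'$ and $G$ (for example Lie groups) act by conformal transformations on $M$ and $N$ respectively, with conformal factors $\Omega_M(h,\cdot)$ $(h\in G')$ and $\Omega_N(h,\cdot)$ $(h\in G)$, and let $i:G'\to G$ be a homomorphism such that $i(h)\,\Phi(x)=\Phi(hx)$ for all $h\in G'$, $x\in M$. Then: 1. For all $h\in G'$ and $x\in M$, $\ \Omega(hx)\,\Omega_M(h,x)=\Omega(x)\,\Omega_N(i(h),\Phi(x))$. 2. For every $\lambda\in\mathbb C$ and $h\in G'$, $\ \Phi_\lambda^*\circ\varpi_{N,\lambda}(i(h))=\varpi_{M,\lambda}(h)\circ\Phi_\lambda^*$. 3. $\widetilde{\Phi^*}$ maps $\operatorname{Ker}\widetilde\Delta_N$ into $\operatorname{Ker}\widetilde\Delta_M$. The group $G$ preserves $\operatorname{Ker}\widetilde\Delta_N$ through $\varpi_N$, the group $G'$ preserves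 $\operatorname{Ker}\widetilde\Delta_M$ through $\varpi_M$, and $\widetilde{\Phi^*}\,\varpi_N(i(h))f=\varpi_M(h)\,\widetilde{\Phi^*}f$ for all $h\in G'$ and $f\in\operatorname{Ker}\widetilde\Delta_N$. 4. If $\Phi$ is a diffeomorphism onto $N$, then $\Phi^{-1}$ is conformal and $(\Phi^{-1})_\lambda^*$ is the two-sided inverse of $\Phi_\lambda^*$ for every $\lambda\in\mathbb C$. In particular $\widetilde{\Phi^*}$ is a bijection from $\operatorname{Ker}\widetilde\Delta_N$ onto $\operatorname{Ker}\widetilde\Delta_M$ with inverse $\widetilde{(\Phi^{-1})^*}$. -/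

import Mathlib

open scoped Manifold ContDiff Bundle

noncomputable section

namespace ConformalGeometry

/-- The model space `ℝⁿ`. -/
abbrev Model (n : ℕ) : Type := EuclideanSpace ℝ (Fin n)

/-! ### Levi-Civita connection, curvature and Laplacian of a metric on an open piece of `ℝⁿ`

A metric is a function `g : ℝⁿ → (ℝⁿ → (ℝⁿ)^*)`, `g y u v` being the product at the point `y` of
the vectors `u` and `v`. All the quantities at `y` depend only on the germ of `g` at `y`. -/

section Local

variable {n : ℕ}

/-- The `i`-th coordinate vector field `∂ᵢ`. -/
def coordVec (i : Fin n) : Model n := EuclideanSpace.single i 1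

/-- The vector `dxⁱ` raised by the bilinear form `b`, that is `∑ⱼ bⁱʲ ∂ⱼ`
(the junk value `0` when `b` is degenerate). -/
def raisedCovec (b : Model n →L[ℝ] Model n →L[ℝ] ℝ) (i : Fin n) : Model n :=
  ContinuousLinearMap.inverse b (EuclideanSpace.proj i)

/-- The trace `∑ᵢⱼ bⁱʲ B(∂ⱼ, ∂ᵢ)` of the bilinear map `B` with respect to `b`. -/
def metricTrace {F : Type*} [AddCommMonoid F] (b : Model n →L[ℝ] Model n →L[ℝ] ℝ)
    (B : Model n → Model n → F) : F :=
  ∑ i, B (raisedCovec b i) (coordVec i)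

/-- The Christoffel symbols `Γ(u, v) = ∇ᵤ v` (constant vector fields `u`, `v`) of the Levi-Civita
connection of `g`, given by the Koszul formula
`2 g(Γ(u, v), w) = D_u g (v, w) + D_v g (u, w) - D_w g (u, v)`. -/
def christoffel (g : Model n → Model n →L[ℝ] Model n →L[ℝ] ℝ) (y u v : Model n) : Model n :=
  ContinuousLinearMap.inverse (g y) ((1 / 2 : ℝ) •
    (fderiv ℝ g y u v + fderiv ℝ g y v u - ((fderiv ℝ g y).flip u).flip v))

/-- The curvature tensor `R(u, v) w = ∇ᵤ ∇ᵥ w - ∇ᵥ ∇ᵤ w`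
(constant vector fields `u`, `v`, `w`, so that `[u, v] = 0`). -/
def curvature (g : Model n → Model n →L[ℝ] Model n →L[ℝ] ℝ) (y u v w : Model n) : Model n :=
  (fderiv ℝ (fun z => christoffel g z v w) y u + christoffel g y u (christoffel g y v w))
    - (fderiv ℝ (fun z => christoffel g z u w) y v + christoffel g y v (christoffel g y u w))

/-- The Ricci tensor: `Ric(v, w)` is the trace of `u ↦ R(u, v) w`. -/
def ricci (g : Model n → Model n →L[ℝ] Model n →L[ℝ] ℝ) (y v w : Model n) : ℝ :=
  ∑ i, (curvature g y (coordVec i) v w) i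

/-- The scalar curvature, the metric trace of the Ricci tensor (positive on round spheres). -/
def localScalarCurvature (g : Model n → Model n →L[ℝ] Model n →L[ℝ] ℝ) (y : Model n) : ℝ :=
  metricTrace (g y) (ricci g y)

/-- The Hessian `∇df (u, v) = D²f (u, v) - df (Γ(u, v))`. -/
def hessian (g : Model n → Model n →L[ℝ] Model n →L[ℝ] ℝ) (f : Model n → ℂ)
    (y u v : Model n) : ℂ :=
  fderiv ℝ (fderiv ℝ f) y u v - fderiv ℝ f y (christoffel g y u v)

/-- The Laplace-Beltrami operator, the metric trace of the Hessian. -/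
def localLaplacian (g : Model n → Model n →L[ℝ] Model n →L[ℝ] ℝ) (f : Model n → ℂ)
    (y : Model n) : ℂ :=
  metricTrace (g y) (hessian g f y)

end Local

/-! ### Pseudo-Riemannian manifolds -/

section Manifolds

variable {n : ℕ}
  {M : Type*} [TopologicalSpace M] [ChartedSpace (Model n) M] [IsManifold (𝓡 n) ∞ M]
  {N : Type*} [TopologicalSpace N] [ChartedSpace (Model n) N] [IsManifold (𝓡 n) ∞ N]

variable (n M) in
/-- A pseudo-Riemannian metric: a smooth field of nondegenerate symmetric bilinear forms on the
tangent spaces. -/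
structure PseudoRiemannianMetric where
  /-- The bilinear form on the tangent space at `x`. -/
  val (x : M) : TangentSpace (𝓡 n) x →L[ℝ] TangentSpace (𝓡 n) x →L[ℝ] ℝ
  symm (x : M) (u v : TangentSpace (𝓡 n) x) : val x u v = val x v u
  nondegenerate (x : M) (u : TangentSpace (𝓡 n) x) (hu : ∀ v, val x u v = 0) : u = 0
  contMDiff : ContMDiff (𝓡 n) ((𝓡 n).prod 𝓘(ℝ, Model n →L[ℝ] Model n →L[ℝ] ℝ)) ∞
    (fun x => Bundle.TotalSpace.mk' (Model n →L[ℝ] Model n →L[ℝ] ℝ)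
      (E := fun x : M => TangentSpace (𝓡 n) x →L[ℝ] TangentSpace (𝓡 n) x →L[ℝ] ℝ) x (val x))

/-- The metric `g` in the preferred chart `φ` at `x`, that is the pull-back of `g` under `φ⁻¹`
(meaningful on the target of `φ`). -/
def PseudoRiemannianMetric.inChart (g : PseudoRiemannianMetric n M) (x : M) (y : Model n) :
    Model n →L[ℝ] Model n →L[ℝ] ℝ :=
  let b : Model n →L[ℝ] Model n →L[ℝ] ℝ := g.val ((extChartAt (𝓡 n) x).symm y)
  let A : Model n →L[ℝ] Model n := mfderiv (𝓡 n) (𝓡 n) (extChartAt (𝓡 n) x).symm y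
  b.bilinearComp A A

/-- The scalar curvature of a pseudo-Riemannian manifold. -/
def scalarCurvature (g : PseudoRiemannianMetric n M) (x : M) : ℝ :=
  localScalarCurvature (g.inChart x) (extChartAt (𝓡 n) x x)

/-- The Laplace-Beltrami operator of a pseudo-Riemannian manifold on complex functions. -/
def laplacian (g : PseudoRiemannianMetric n M) (f : M → ℂ) (x : M) : ℂ :=
  localLaplacian (g.inChart x) (f ∘ (extChartAt (𝓡 n) x).symm) (extChartAt (𝓡 n) x x)

variable (n M) in
/-- The complex vector space `C^∞(M)` of smooth complex-valued functions. -/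
def smoothFunctions : Submodule ℂ (M → ℂ) where
  carrier := {f | ContMDiff (𝓡 n) 𝓘(ℝ, ℂ) ∞ f}
  add_mem' hf hg := ContMDiff.add hf hg
  zero_mem' := contMDiff_const
  smul_mem' _ _ hf := contDiff_const.mul contDiff_id |>.comp_contMDiff hf

theorem contDiffAt_inChart {f : M → ℂ} (hf : f ∈ smoothFunctions n M) (x : M) :
    ContDiffAt ℝ ∞ (f ∘ (extChartAt (𝓡 n) x).symm) (extChartAt (𝓡 n) x x) := by
  have h := (contMDiffAt_iff.1 (ContMDiff.contMDiffAt (x := x) hf)).2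
  rw [modelWithCornersSelf_coe, Set.range_id, contDiffWithinAt_univ, extChartAt_model_space_eq_id] at h
  exact h

theorem hessian_add {g : Model n → Model n →L[ℝ] Model n →L[ℝ] ℝ} {f₁ f₂ : Model n → ℂ}
    {y : Model n} (h₁ : ContDiffAt ℝ ∞ f₁ y) (h₂ : ContDiffAt ℝ ∞ f₂ y) (u v : Model n) :
    hessian g (f₁ + f₂) y u v = hessian g f₁ y u v + hessian g f₂ y u v := by
  have e : fderiv ℝ (f₁ + f₂) =ᶠ[nhds y] fderiv ℝ f₁ + fderiv ℝ f₂ := by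
    filter_upwards [(h₁.of_le (m := 1) (by norm_cast)).eventually (by simp),
      (h₂.of_le (m := 1) (by norm_cast)).eventually (by simp)] with z a b
    exact fderiv_add (a.differentiableAt one_ne_zero) (b.differentiableAt one_ne_zero)
  have d₁ := (h₁.fderiv_right (m := 1) (by norm_cast)).differentiableAt one_ne_zero
  have d₂ := (h₂.fderiv_right (m := 1) (by norm_cast)).differentiableAt one_ne_zero
  unfold hessian
  rw [e.fderiv_eq, e.self_of_nhds, fderiv_add d₁ d₂]
  simp only [Pi.add_apply, add_apply]
  ring

theorem hessian_smul {g : Model n → Model n →L[ℝ] Model n →L[ℝ] ℝ} {f : Model n → ℂ}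
    {y : Model n} (h : ContDiffAt ℝ ∞ f y) (c : ℂ) (u v : Model n) :
    hessian g (c • f) y u v = c * hessian g f y u v := by
  have e : fderiv ℝ (c • f) =ᶠ[nhds y] c • fderiv ℝ f := by
    filter_upwards [(h.of_le (m := 1) (by norm_cast)).eventually (by simp)] with z a
    exact fderiv_const_smul (a.differentiableAt one_ne_zero) c
  have d := (h.fderiv_right (m := 1) (by norm_cast)).differentiableAt one_ne_zero
  unfold hessian
  rw [e.fderiv_eq, e.self_of_nhds, fderiv_const_smul d c]
  simp only [Pi.smul_apply, smul_apply, smul_eq_mul]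
  ring

/-- The Yamabe operator `Δ - (n - 2) / (4 (n - 1)) K` on smooth functions. -/
def yamabe (g : PseudoRiemannianMetric n M) : smoothFunctions n M →ₗ[ℂ] (M → ℂ) where
  toFun f x := laplacian g f x
    - (((n : ℝ) - 2) / (4 * ((n : ℝ) - 1)) * scalarCurvature g x : ℝ) * (f : M → ℂ) x
  map_add' f₁ f₂ := by
    funext x
    have := fun u v => hessian_add (g := g.inChart x)
      (contDiffAt_inChart f₁.2 x) (contDiffAt_inChart f₂.2 x) u v
    have e : laplacian g (f₁ + f₂ : smoothFunctions n M) x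
        = laplacian g f₁ x + laplacian g f₂ x := by
      simp only [laplacian, localLaplacian, metricTrace, ← Finset.sum_add_distrib]
      exact Finset.sum_congr rfl fun i _ => this _ _
    rw [e]
    simp only [Pi.add_apply, Submodule.coe_add]
    ring
  map_smul' c f := by
    funext x
    have := fun u v => hessian_smul (g := g.inChart x) (contDiffAt_inChart f.2 x) c u v
    have e : laplacian g (c • f : smoothFunctions n M) x = c * laplacian g f x := by
      simp only [laplacian, localLaplacian, metricTrace, Finset.mul_sum]
      exact Finset.sum_congr rfl fun i _ => this _ _
    rw [e]
    simp only [Pi.smul_apply, Submodule.coe_smul, smul_eq_mul, RingHom.id_apply]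
    ring

/-- The kernel of the Yamabe operator in `C^∞(M)`. -/
def yamabeKer (g : PseudoRiemannianMetric n M) : Submodule ℂ (smoothFunctions n M) :=
  LinearMap.ker (yamabe g)

/-! ### Conformal maps and twisted pull-backs -/

/-- `Ω` is a conformal factor of `Φ`: it is positive and `Φ^* g_N = Ω² g_M`. -/
def IsConformalFactor (gM : PseudoRiemannianMetric n M) (gN : PseudoRiemannianMetric n N)
    (Φ : M → N) (Ω : M → ℝ) : Prop :=
  (∀ x, 0 < Ω x) ∧ ∀ (x : M) (u v : TangentSpace (𝓡 n) x),
    gN.val (Φ x) (mfderiv (𝓡 n) (𝓡 n) Φ x u) (mfderiv (𝓡 n) (𝓡 n) Φ x v)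
      = Ω x ^ 2 * gM.val x u v

/-- A conformal map: a local diffeomorphism that has a conformal factor. -/
structure IsConformalMap (gM : PseudoRiemannianMetric n M) (gN : PseudoRiemannianMetric n N)
    (Φ : M → N) : Prop where
  isLocalDiffeomorph : IsLocalDiffeomorph (𝓡 n) (𝓡 n) ∞ Φ
  exists_factor : ∃ Ω : M → ℝ, IsConformalFactor gM gN Φ Ω

/-- The conformal factor of a conformal map (it is unique when `n ≥ 1`). -/
def IsConformalMap.factor {gM : PseudoRiemannianMetric n M} {gN : PseudoRiemannianMetric n N}
    {Φ : M → N} (hΦ : IsConformalMap gM gN Φ) : M → ℝ :=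
  hΦ.exists_factor.choose

theorem IsConformalMap.isConformalFactor {gM : PseudoRiemannianMetric n M}
    {gN : PseudoRiemannianMetric n N} {Φ : M → N} (hΦ : IsConformalMap gM gN Φ) :
    IsConformalFactor gM gN Φ hΦ.factor :=
  hΦ.exists_factor.choose_spec

theorem PseudoRiemannianMetric.exists_ne_zero [NeZero n] (g : PseudoRiemannianMetric n M) (x : M) :
    ∃ u v : TangentSpace (𝓡 n) x, g.val x u v ≠ 0 := by
  by_contra! h
  have : (EuclideanSpace.single (0 : Fin n) (1 : ℝ) : Model n) = 0 :=
    g.nondegenerate x (EuclideanSpace.single (0 : Fin n) (1 : ℝ) : Model n) (h _)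
  simpa using congrArg (fun w : Model n => w 0) this

theorem IsConformalFactor.unique [NeZero n] {gM : PseudoRiemannianMetric n M}
    {gN : PseudoRiemannianMetric n N} {Φ : M → N} {Ω₁ Ω₂ : M → ℝ}
    (h₁ : IsConformalFactor gM gN Φ Ω₁) (h₂ : IsConformalFactor gM gN Φ Ω₂) : Ω₁ = Ω₂ := by
  funext x
  obtain ⟨u, v, huv⟩ := gM.exists_ne_zero x
  have h := mul_right_cancel₀ huv ((h₁.2 x u v).symm.trans (h₂.2 x u v))
  exact (pow_left_inj₀ (h₁.1 x).le (h₂.1 x).le two_ne_zero).1 h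

theorem IsConformalFactor.contMDiff [NeZero n] {gM : PseudoRiemannianMetric n M}
    {gN : PseudoRiemannianMetric n N} {Φ : M → N} {Ω : M → ℝ}
    (hΦ : ContMDiff (𝓡 n) (𝓡 n) ∞ Φ) (h : IsConformalFactor gM gN Φ Ω) :
    ContMDiff (𝓡 n) 𝓘(ℝ, ℝ) ∞ Ω := by
  intro x₀
  obtain ⟨u, v, huv⟩ := gM.exists_ne_zero x₀
  set U := FiberBundle.extend (E := fun x : M => TangentSpace (𝓡 n) x) (Model n) u with hU
  set V := FiberBundle.extend (E := fun x : M => TangentSpace (𝓡 n) x) (Model n) v with hV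
  have sU : ContMDiffAt (𝓡 n) ((𝓡 n).prod 𝓘(ℝ, Model n)) ∞
      (fun x => Bundle.TotalSpace.mk' (Model n) x (U x)) x₀ :=
    FiberBundle.contMDiffAt_extend (𝓡 n) (Model n) u
  have sV : ContMDiffAt (𝓡 n) ((𝓡 n).prod 𝓘(ℝ, Model n)) ∞
      (fun x => Bundle.TotalSpace.mk' (Model n) x (V x)) x₀ :=
    FiberBundle.contMDiffAt_extend (𝓡 n) (Model n) v
  have sM : ContMDiffAt (𝓡 n) 𝓘(ℝ, ℝ) ∞ (fun x => gM.val x (U x) (V x)) x₀ := by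
    have := ContMDiffAt.clm_bundle_apply₂ (F₁ := Model n) (F₂ := Model n) (F₃ := ℝ)
      (E₃ := Bundle.Trivial M ℝ) (gM.contMDiff x₀) sU sV
    simp only [Bundle.contMDiffAt_totalSpace] at this
    exact this.2
  have sN : ContMDiffAt (𝓡 n) 𝓘(ℝ, ℝ) ∞ (fun x => gN.val (Φ x)
      (mfderiv (𝓡 n) (𝓡 n) Φ x (U x)) (mfderiv (𝓡 n) (𝓡 n) Φ x (V x))) x₀ := by
    have t := hΦ.contMDiff_tangentMap (m := ∞) (by norm_cast)
    have tU := (t.contMDiffAt (x := ⟨x₀, U x₀⟩)).comp x₀ sU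
    have tV := (t.contMDiffAt (x := ⟨x₀, V x₀⟩)).comp x₀ sV
    have := ContMDiffAt.clm_bundle_apply₂ (F₁ := Model n) (F₂ := Model n) (F₃ := ℝ)
      (E₃ := Bundle.Trivial N ℝ) ((gN.contMDiff (Φ x₀)).comp x₀ (hΦ x₀)) tU tV
    simp only [Bundle.contMDiffAt_totalSpace] at this
    exact this.2
  have ne : gM.val x₀ (U x₀) (V x₀) ≠ 0 := by simpa [hU, hV] using huv
  have ev : ∀ᶠ x in nhds x₀, gM.val x (U x) (V x) ≠ 0 := sM.continuousAt.eventually_ne ne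
  have e : (fun x => √(gN.val (Φ x) (mfderiv (𝓡 n) (𝓡 n) Φ x (U x))
      (mfderiv (𝓡 n) (𝓡 n) Φ x (V x)) / gM.val x (U x) (V x))) =ᶠ[nhds x₀] Ω := by
    filter_upwards [ev] with x hx
    rw [h.2, mul_div_cancel_right₀ _ hx, Real.sqrt_sq (h.1 x).le]
  refine ContMDiffAt.congr_of_eventuallyEq ?_ e.symm
  have q := sN.div₀ sM ne
  refine ContDiffAt.comp_contMDiffAt (g := Real.sqrt) (Real.contDiffAt_sqrt ?_) q
  have := h.2 x₀ (U x₀) (V x₀)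
  change gN.val (Φ x₀) _ _ / gM.val x₀ _ _ ≠ 0
  rw [this, mul_div_cancel_right₀ _ ne]
  exact (pow_pos (h.1 x₀) 2).ne'

theorem contMDiff_ofReal_cpow {Ω : M → ℝ} (hΩ : ContMDiff (𝓡 n) 𝓘(ℝ, ℝ) ∞ Ω)
    (pos : ∀ x, 0 < Ω x) (lam : ℂ) :
    ContMDiff (𝓡 n) 𝓘(ℝ, ℂ) ∞ (fun x => (Ω x : ℂ) ^ lam) := by
  intro x
  have h : ContDiffAt ℝ ∞ (fun t : ℝ => Complex.exp ((Real.log t : ℂ) * lam)) (Ω x) := by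
    have := Real.contDiffAt_log (n := ∞) |>.2 (pos x).ne'
    have := (Complex.ofRealCLM.contDiff (n := ∞)).contDiffAt.comp (Ω x) this
    exact (this.mul contDiffAt_const).cexp
  refine (h.comp_contMDiffAt (hΩ x)).congr_of_eventuallyEq (Filter.Eventually.of_forall fun z => ?_)
  simp only [Function.comp_apply]
  rw [Complex.cpow_def_of_ne_zero (by exact_mod_cast (pos z).ne'), Complex.ofReal_log (pos z).le]

/-- The twisted pull-back `Φ_λ^* : C^∞(N) → C^∞(M)`, `f ↦ Ω^λ (f ∘ Φ)`. -/
def twistedPullback [NeZero n] {gM : PseudoRiemannianMetric n M} {gN : PseudoRiemannianMetric n N}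
    {Φ : M → N} (hΦ : IsConformalMap gM gN Φ) (lam : ℂ) :
    smoothFunctions n N →ₗ[ℂ] smoothFunctions n M where
  toFun f := ⟨fun x => (hΦ.factor x : ℂ) ^ lam * (f : N → ℂ) (Φ x),
    (contDiff_fst.mul contDiff_snd).comp_contMDiff ((contMDiff_ofReal_cpow
      (hΦ.isConformalFactor.contMDiff hΦ.isLocalDiffeomorph.contMDiff)
      hΦ.isConformalFactor.1 lam).prodMk_space
      (ContMDiff.comp (I' := 𝓡 n) (g := (f : N → ℂ)) f.2 hΦ.isLocalDiffeomorph.contMDiff))⟩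
  map_add' f₁ f₂ := by
    ext x
    simp [mul_add]
  map_smul' c f := by
    ext x
    simp [mul_left_comm]

/-! ### Conformal actions -/

variable {G : Type*} [Group G] [MulAction G M]

variable (G) in
/-- The group `G` acts on `M` by conformal transformations. -/
def IsConformalAction (g : PseudoRiemannianMetric n M) : Prop :=
  ∀ h : G, IsConformalMap g g (fun x : M => h • x)

/-- The conformal factor `Ω(h, x)` of a conformal action: `L_h^* g = Ω(h, ·)² g`. -/
def IsConformalAction.factor {g : PseudoRiemannianMetric n M} (hG : IsConformalAction G g)
    (h : G) (x : M) : ℝ :=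
  (hG h).factor x

theorem IsConformalAction.factor_one [NeZero n] {g : PseudoRiemannianMetric n M}
    (hG : IsConformalAction G g) (x : M) : hG.factor 1 x = 1 := by
  have h : IsConformalFactor g g (fun x : M => (1 : G) • x) (fun _ => 1) := by
    refine ⟨fun _ => one_pos, fun x u v => ?_⟩
    have e : (fun x : M => (1 : G) • x) = id := funext fun x => one_smul G x
    have : ∀ Ψ : M → M, Ψ = id → g.val (Ψ x) (mfderiv (𝓡 n) (𝓡 n) Ψ x u)
        (mfderiv (𝓡 n) (𝓡 n) Ψ x v) = 1 ^ 2 * g.val x u v := by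
      rintro _ rfl
      rw [mfderiv_id, one_pow, one_mul]
      rfl
    exact this _ e
  exact congrFun ((hG 1).isConformalFactor.unique h) x

theorem IsConformalAction.factor_mul [NeZero n] {g : PseudoRiemannianMetric n M}
    (hG : IsConformalAction G g) (h₁ h₂ : G) (x : M) :
    hG.factor (h₁ * h₂) x = hG.factor h₁ (h₂ • x) * hG.factor h₂ x := by
  have h : IsConformalFactor g g (fun x : M => (h₁ * h₂) • x)
      (fun x => hG.factor h₁ (h₂ • x) * hG.factor h₂ x) := by
    refine ⟨fun x => mul_pos ((hG h₁).isConformalFactor.1 _) ((hG h₂).isConformalFactor.1 _),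
      fun x u v => ?_⟩
    have e : (fun x : M => (h₁ * h₂) • x) = (fun x : M => h₁ • x) ∘ (fun x : M => h₂ • x) :=
      funext fun x => mul_smul h₁ h₂ x
    have d : ∀ h : G, MDifferentiable (𝓡 n) (𝓡 n) (fun x : M => h • x) := fun h =>
      (hG h).isLocalDiffeomorph.contMDiff.mdifferentiable (by simp)
    have : ∀ Ψ : M → M, Ψ = (fun x : M => h₁ • x) ∘ (fun x : M => h₂ • x) →
        g.val (Ψ x) (mfderiv (𝓡 n) (𝓡 n) Ψ x u) (mfderiv (𝓡 n) (𝓡 n) Ψ x v)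
          = (hG.factor h₁ (h₂ • x) * hG.factor h₂ x) ^ 2 * g.val x u v := by
      rintro _ rfl
      rw [mfderiv_comp x (d h₁ (h₂ • x)) (d h₂ x)]
      refine ((hG h₁).isConformalFactor.2 (h₂ • x) _ _).trans ?_
      refine (congrArg _ ((hG h₂).isConformalFactor.2 x u v)).trans ?_
      rw [← mul_assoc, ← mul_pow]
      rfl
    exact this _ e
  exact congrFun ((hG (h₁ * h₂)).isConformalFactor.unique h) x

/-- The representation `ϖ_λ` of `G` on `C^∞(M)`: `(ϖ_λ(h⁻¹) f)(x) = Ω(h, x)^λ f(h x)`, so that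
`ϖ_λ(h)` is the twisted pull-back by the action of `h⁻¹`. -/
def varpi [NeZero n] {g : PseudoRiemannianMetric n M} (hG : IsConformalAction G g) (lam : ℂ) :
    Representation ℂ G (smoothFunctions n M) where
  toFun h := twistedPullback (hG h⁻¹) lam
  map_one' := by
    ext f x
    have e : (hG (1 : G)⁻¹).factor x = 1 := by
      have := hG.factor_one x
      rwa [← inv_one] at this
    change ((hG (1 : G)⁻¹).factor x : ℂ) ^ lam * (f : M → ℂ) ((1 : G)⁻¹ • x) = (f : M → ℂ) x
    rw [e]
    simp
  map_mul' h₁ h₂ := by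
    ext f x
    have e : (hG (h₁ * h₂)⁻¹).factor x
        = (hG h₂⁻¹).factor (h₁⁻¹ • x) * (hG h₁⁻¹).factor x := by
      have := hG.factor_mul h₂⁻¹ h₁⁻¹ x
      rwa [← mul_inv_rev] at this
    change ((hG (h₁ * h₂)⁻¹).factor x : ℂ) ^ lam * (f : M → ℂ) ((h₁ * h₂)⁻¹ • x)
      = ((hG h₁⁻¹).factor x : ℂ) ^ lam * (((hG h₂⁻¹).factor (h₁⁻¹ • x) : ℂ) ^ lam
        * (f : M → ℂ) (h₂⁻¹ • h₁⁻¹ • x))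
    rw [e, mul_inv_rev, mul_smul, Complex.ofReal_mul,
      Complex.mul_cpow_ofReal_nonneg ((hG h₂⁻¹).isConformalFactor.1 _).le
        ((hG h₁⁻¹).isConformalFactor.1 _).le]
    ring

end Manifolds

end ConformalGeometry

end

/-
In charts, `Φ` is a local diffeomorphism `F` between open subsets of `ℝⁿ` with `F^* g' = Ω² g`.
Scalar curvature and Laplacian commute with pull-back along `F`, so the covariance of the Yamabe
operator reduces to the change of metric `g ↦ exp(2φ) g` with `φ = log Ω`. There the Christoffel
symbols change by `C(u, v) = dφ(u) v + dφ(v) u - g(u, v) grad φ`, and hence, up to terms that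
cancel in the trace, the curvature changes through the symmetric tensor
`∇dφ - dφ ⊗ dφ + ½ |dφ|² g`. The exponent `(n - 2) / 2` is the one for which the first order terms
of `Δ (exp(μ φ) p)` and the curvature term combine to
`Yamabe_g (Ω^μ p) = Ω^(μ + 2) Yamabe_{Ω² g} p`.

The remaining assertions are formal: conformal factors are unique, so `Φ ↦ Φ_λ^*` is a contravariant
functor, and commuting squares and inverses of conformal maps give those of twisted pull-backs.
-/

noncomputable section

set_option maxSynthPendingDepth 3

namespace ConformalGeometry

section Calculus

variable {D E F : Type*} [NormedAddCommGroup D] [NormedSpace ℝ D]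
  [NormedAddCommGroup E] [NormedSpace ℝ E] [NormedAddCommGroup F] [NormedSpace ℝ F]
  {B : D → E →L[ℝ] E →L[ℝ] F} {U V : D → E} {y : D}

theorem fderiv_bilin_apply (hB : DifferentiableAt ℝ B y) (hU : DifferentiableAt ℝ U y)
    (hV : DifferentiableAt ℝ V y) (a : D) :
    fderiv ℝ (fun z => B z (U z) (V z)) y a
      = fderiv ℝ B y a (U y) (V y) + B y (fderiv ℝ U y a) (V y)
        + B y (U y) (fderiv ℝ V y a) := by
  rw [fderiv_clm_apply (hB.clm_apply hU) hV, fderiv_clm_apply hB hU]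
  simp only [_root_.add_apply, ContinuousLinearMap.comp_apply, ContinuousLinearMap.flip_apply]
  abel

theorem fderiv_bilin_apply_const (hB : DifferentiableAt ℝ B y) (u v : E) (a : D) :
    fderiv ℝ (fun z => B z u v) y a = fderiv ℝ B y a u v := by
  simp [fderiv_bilin_apply hB (differentiableAt_const u) (differentiableAt_const v)]

theorem fderiv_clm_apply_const {A : D → E →L[ℝ] F} (hA : DifferentiableAt ℝ A y) (u : E) (a : D) :
    fderiv ℝ (fun z => A z u) y a = fderiv ℝ A y a u := by
  simp [fderiv_clm_apply hA (differentiableAt_const u)]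

theorem contDiffAt_clm_apply [FiniteDimensional ℝ E] {m : WithTop ℕ∞} {A : D → E →L[ℝ] F} :
    ContDiffAt ℝ m A y ↔ ∀ u, ContDiffAt ℝ m (fun z => A z u) y := by
  refine ⟨fun h u => h.clm_apply contDiffAt_const, fun h => ?_⟩
  let e₁ : E ≃L[ℝ] (Fin (Module.finrank ℝ E) → ℝ) :=
    ContinuousLinearEquiv.ofFinrankEq (Module.finrank_fin_fun ℝ).symm
  let e₂ := (e₁.arrowCongr (.refl ℝ F)).trans (ContinuousLinearEquiv.piRing _)
  rw [← e₂.comp_contDiffAt_iff]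
  exact contDiffAt_pi.2 fun i => h _

theorem contDiffAt_bilin_apply [FiniteDimensional ℝ E] {m : WithTop ℕ∞} :
    ContDiffAt ℝ m B y ↔ ∀ u v, ContDiffAt ℝ m (fun z => B z u v) y := by
  simp only [contDiffAt_clm_apply]

theorem differentiableAt_fderiv {f : D → F} (hf : ContDiffAt ℝ 2 f y) :
    DifferentiableAt ℝ (fderiv ℝ f) y :=
  (hf.fderiv_right (m := 1) (by norm_num)).differentiableAt one_ne_zero

theorem fderiv_fderiv_comm {f : D → F} (hf : ContDiffAt ℝ 2 f y) (u v : D) :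
    fderiv ℝ (fderiv ℝ f) y u v = fderiv ℝ (fderiv ℝ f) y v u :=
  hf.isSymmSndFDerivAt (by simp) u v

end Calculus

section Trace

variable {E F : Type*} [NormedAddCommGroup E] [NormedSpace ℝ E] [FiniteDimensional ℝ E]

variable (E) in
/-- The trace of an endomorphism, as a continuous linear functional. -/
def endTrace : (E →L[ℝ] E) →L[ℝ] ℝ :=
  (LinearMap.trace ℝ E ∘ₗ ContinuousLinearMap.coeLM ℝ).toContinuousLinearMap

theorem endTrace_apply (A : E →L[ℝ] E) : endTrace E A = LinearMap.trace ℝ E A := rfl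

theorem endTrace_id : endTrace E (ContinuousLinearMap.id ℝ E) = Module.finrank ℝ E := by
  simp [endTrace_apply]

theorem endTrace_smulRight (l : E →L[ℝ] ℝ) (v : E) : endTrace E (l.smulRight v) = l v :=
  LinearMap.trace_smulRight l.toLinearMap v

theorem endTrace_eq_of_semiconj {E' : Type*} [NormedAddCommGroup E'] [NormedSpace ℝ E']
    [FiniteDimensional ℝ E'] {S : E →L[ℝ] E} {T : E' →L[ℝ] E'} (A : E ≃L[ℝ] E')
    (h : ∀ u, A (S u) = T (A u)) : endTrace E S = endTrace E' T := by
  have conj : T.toLinearMap = A.toLinearEquiv.conj S.toLinearMap := by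
    ext u
    obtain ⟨v, rfl⟩ := A.surjective u
    simpa [LinearEquiv.conj_apply] using (h v).symm
  rw [endTrace_apply, endTrace_apply, conj, LinearMap.trace_conj']

end Trace

section MetricTrace

variable {n : ℕ} {F : Type*} [NormedAddCommGroup F] [NormedSpace ℝ F]
  {b : Model n →L[ℝ] Model n →L[ℝ] ℝ} {A : Model n →L[ℝ] Model n}

theorem sum_smul_coordVec (v : Model n) : ∑ i, v i • coordVec i = v := by
  simpa [coordVec] using (EuclideanSpace.basisFun (Fin n) ℝ).sum_repr v

theorem endTrace_eq_sum (A : Model n →L[ℝ] Model n) :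
    endTrace (Model n) A = ∑ i, A (coordVec i) i := by
  rw [endTrace_apply, LinearMap.trace_eq_matrix_trace ℝ
    (EuclideanSpace.basisFun (Fin n) ℝ).toBasis, Matrix.trace]
  simp [LinearMap.toMatrix_apply, coordVec]

theorem apply_raisedCovec (hb : b.IsInvertible) (i : Fin n) (v : Model n) :
    b (raisedCovec b i) v = v i := by
  rw [raisedCovec, hb.self_apply_inverse]
  rfl

theorem ext_of_isInvertible (hb : b.IsInvertible) {u v : Model n} (h : ∀ w, b u w = b v w) :
    u = v :=
  hb.injective (ContinuousLinearMap.ext h)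

theorem metricTrace_eq_endTrace (hb : b.IsInvertible) {B : Model n → Model n → ℝ}
    (S : Model n →L[ℝ] Model n) (hS : ∀ u v, B u v = b u (S v)) :
    metricTrace b B = endTrace (Model n) S := by
  simp only [endTrace_eq_sum, metricTrace, hS, apply_raisedCovec hb]

theorem metricTrace_add {F : Type*} [AddCommMonoid F] (b : Model n →L[ℝ] Model n →L[ℝ] ℝ)
    (B C : Model n → Model n → F) :
    metricTrace b (fun u v => B u v + C u v) = metricTrace b B + metricTrace b C :=
  Finset.sum_add_distrib

theorem metricTrace_mul_left {R : Type*} [NonUnitalNonAssocSemiring R]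
    (b : Model n →L[ℝ] Model n →L[ℝ] ℝ) (c : R) (B : Model n → Model n → R) :
    metricTrace b (fun u v => c * B u v) = c * metricTrace b B :=
  (Finset.mul_sum ..).symm

theorem metricTrace_mul_right {R : Type*} [NonUnitalNonAssocSemiring R]
    (b : Model n →L[ℝ] Model n →L[ℝ] ℝ) (B : Model n → Model n → R) (c : R) :
    metricTrace b (fun u v => B u v * c) = metricTrace b B * c :=
  (Finset.sum_mul ..).symm

theorem metricTrace_ofReal (b : Model n →L[ℝ] Model n →L[ℝ] ℝ) (B : Model n → Model n → ℝ) :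
    metricTrace b (fun u v => (B u v : ℂ)) = (metricTrace b B : ℝ) :=
  (Complex.ofReal_sum ..).symm

theorem metricTrace_self (hb : b.IsInvertible) : metricTrace b (fun u v => b u v) = n :=
  (metricTrace_eq_endTrace hb (.id ℝ _) fun _ _ => rfl).trans
    (by rw [endTrace_id, finrank_euclideanSpace_fin])

theorem metricTrace_smul_left (hb : b.IsInvertible) (hs : ∀ u v, b u v = b v u)
    (α : Model n →L[ℝ] ℝ) (l : Model n →L[ℝ] F) :
    metricTrace b (fun u v => α u • l v) = l (b.inverse α) := by
  have coord (i : Fin n) : α (raisedCovec b i) = (b.inverse α) i := by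
    rw [← apply_raisedCovec hb, hs, hb.self_apply_inverse]
  simp only [metricTrace, coord, ← map_smul, ← map_sum, sum_smul_coordVec]

theorem metricTrace_smul_right (α : Model n →L[ℝ] ℝ)
    (l : Model n →L[ℝ] F) : metricTrace b (fun u v => α v • l u) = l (b.inverse α) := by
  simp only [metricTrace, raisedCovec, ← map_smul, ← map_sum]
  congr 2
  ext v
  conv_rhs => rw [← sum_smul_coordVec v]
  simp [mul_comm]

theorem isInvertible_const_smul {E : Type*} [NormedAddCommGroup E] [NormedSpace ℝ E]
    {b : E →L[ℝ] E →L[ℝ] ℝ} (hb : b.IsInvertible) {c : ℝ} (hc : c ≠ 0) : (c • b).IsInvertible := by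
  obtain ⟨β, rfl⟩ := hb
  exact ⟨β.trans (ContinuousLinearEquiv.smulLeft (Units.mk0 c hc)), rfl⟩

theorem metricTrace_const_smul (hb : b.IsInvertible) {c : ℝ} (hc : c ≠ 0)
    (B : Model n →L[ℝ] Model n →L[ℝ] F) :
    metricTrace (c • b) (fun u v => B u v) = c⁻¹ • metricTrace b (fun u v => B u v) := by
  have raised (i : Fin n) : raisedCovec (c • b) i = c⁻¹ • raisedCovec b i := by
    refine ext_of_isInvertible (isInvertible_const_smul hb hc) fun w => ?_
    rw [apply_raisedCovec (isInvertible_const_smul hb hc)]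
    simp [apply_raisedCovec hb, hc]
  simp only [metricTrace, raised, map_smul, _root_.smul_apply, Finset.smul_sum]

theorem isInvertible_bilinearComp {E : Type*} [NormedAddCommGroup E] [NormedSpace ℝ E]
    {b : E →L[ℝ] E →L[ℝ] ℝ} {A : E →L[ℝ] E} (hb : b.IsInvertible) (hA : A.IsInvertible) :
    (b.bilinearComp A A).IsInvertible := by
  obtain ⟨β, rfl⟩ := hb
  obtain ⟨e, rfl⟩ := hA
  exact ⟨(e.trans β).trans (e.symm.arrowCongr (.refl ℝ ℝ)), rfl⟩

theorem metricTrace_bilinearComp (hb : b.IsInvertible) (hA : A.IsInvertible)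
    (B : Model n →L[ℝ] Model n →L[ℝ] F) :
    metricTrace (b.bilinearComp A A) (fun u v => B (A u) (A v))
      = metricTrace b (fun u v => B u v) := by
  have raised (j : Fin n) :
      ∑ i, A (coordVec i) j • A (raisedCovec (b.bilinearComp A A) i) = raisedCovec b j := by
    refine ext_of_isInvertible hb fun v => ?_
    obtain ⟨w, rfl⟩ := hA.surjective v
    have pairing (i : Fin n) : b (A (raisedCovec (b.bilinearComp A A) i)) (A w) = w i :=
      apply_raisedCovec (isInvertible_bilinearComp hb hA) i w
    rw [apply_raisedCovec hb]
    simp only [map_sum, map_smul, _root_.sum_apply, _root_.smul_apply, pairing]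
    conv_rhs => rw [← sum_smul_coordVec w]
    simp [mul_comm]
  calc ∑ i, B (A (raisedCovec (b.bilinearComp A A) i)) (A (coordVec i))
      = ∑ i, ∑ j,
          B (A (coordVec i) j • A (raisedCovec (b.bilinearComp A A) i)) (coordVec j) := by
        refine Finset.sum_congr rfl fun i _ => ?_
        conv_lhs => rw [← sum_smul_coordVec (A (coordVec i))]
        simp
    _ = ∑ j, B (raisedCovec b j) (coordVec j) := by
        rw [Finset.sum_comm]
        simp only [← raised, map_sum, _root_.sum_apply]

end MetricTrace

section Connections

variable {E E' : Type*} [NormedAddCommGroup E] [NormedSpace ℝ E]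
  [NormedAddCommGroup E'] [NormedSpace ℝ E']

/-- The curvature `R(u, v) w = ∇ᵤ ∇ᵥ w - ∇ᵥ ∇ᵤ w` (constant vector fields) of the connection with
Christoffel symbols `Γ`, as a trilinear map. -/
def connCurvature (Γ : E → E →L[ℝ] E →L[ℝ] E) (y : E) : E →L[ℝ] E →L[ℝ] E →L[ℝ] E :=
  let A := fderiv ℝ Γ y + (ContinuousLinearMap.compL ℝ E E E).bilinearComp (Γ y) (Γ y)
  A - A.flip

theorem connCurvature_apply (Γ : E → E →L[ℝ] E →L[ℝ] E) (y u v w : E) :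
    connCurvature Γ y u v w = (fderiv ℝ Γ y u v w + Γ y u (Γ y v w))
      - (fderiv ℝ Γ y v u w + Γ y v (Γ y u w)) := rfl

/-- The covariant derivative of a field `C` of vector-valued bilinear forms with respect to the
connection with Christoffel symbols `Γ`. -/
def covDeriv (Γ C : E → E →L[ℝ] E →L[ℝ] E) (y u v w : E) : E :=
  fderiv ℝ C y u v w + Γ y u (C y v w) - C y (Γ y u v) w - C y v (Γ y u w)

theorem connCurvature_add_apply {Γ C : E → E →L[ℝ] E →L[ℝ] E} {y : E}
    (hΓ : DifferentiableAt ℝ Γ y) (hC : DifferentiableAt ℝ C y)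
    (hs : ∀ u v, Γ y u v = Γ y v u) (u v w : E) :
    connCurvature (Γ + C) y u v w = connCurvature Γ y u v w
      + (covDeriv Γ C y u v w - covDeriv Γ C y v u w)
      + (C y u (C y v w) - C y v (C y u w)) := by
  simp only [connCurvature_apply, covDeriv, fderiv_add hΓ hC, _root_.add_apply, Pi.add_apply,
    map_add, hs v u]
  abel

theorem fderiv_christoffel_of_semiconj {Γ : E → E →L[ℝ] E →L[ℝ] E}
    {Γ' : E' → E' →L[ℝ] E' →L[ℝ] E'} {F : E → E'} {y : E} (hF : ContDiffAt ℝ 3 F y)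
    (hΓ : DifferentiableAt ℝ Γ y) (hΓ' : DifferentiableAt ℝ Γ' (F y))
    (h : ∀ᶠ z in nhds y, ∀ u v, fderiv ℝ F z (Γ z u v)
      = Γ' (F z) (fderiv ℝ F z u) (fderiv ℝ F z v) + fderiv ℝ (fderiv ℝ F) z u v) (a u v : E) :
    fderiv ℝ F y (fderiv ℝ Γ y a u v)
      = fderiv ℝ Γ' (F y) (fderiv ℝ F y a) (fderiv ℝ F y u) (fderiv ℝ F y v)
        + Γ' (F y) (fderiv ℝ (fderiv ℝ F) y a u) (fderiv ℝ F y v)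
        + Γ' (F y) (fderiv ℝ F y u) (fderiv ℝ (fderiv ℝ F) y a v)
        + fderiv ℝ (fderiv ℝ (fderiv ℝ F)) y a u v
        - fderiv ℝ (fderiv ℝ F) y a (Γ y u v) := by
  have dF : DifferentiableAt ℝ F y := hF.differentiableAt (by norm_num)
  have dF' : DifferentiableAt ℝ (fderiv ℝ F) y := differentiableAt_fderiv (hF.of_le (by norm_num))
  have dF'' : DifferentiableAt ℝ (fderiv ℝ (fderiv ℝ F)) y :=
    differentiableAt_fderiv (hF.fderiv_right (by norm_num))
  have dΓ'F : DifferentiableAt ℝ (fun z => Γ' (F z)) y := hΓ'.fun_comp' y dF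
  have eq := congrArg (fun l => l a)
    (Filter.EventuallyEq.fderiv_eq (𝕜 := ℝ) (h.mono fun z hz => hz u v))
  rw [fderiv_fun_add (by fun_prop) (by fun_prop), _root_.add_apply,
    fderiv_clm_apply dF' (by fun_prop), fderiv_bilin_apply dΓ'F (by fun_prop) (by fun_prop),
    fderiv_bilin_apply_const dF'', fderiv_fun_comp y hΓ' dF, fderiv_clm_apply_const dF',
    fderiv_clm_apply_const dF'] at eq
  simp only [_root_.add_apply, ContinuousLinearMap.comp_apply, ContinuousLinearMap.flip_apply,
    fderiv_bilin_apply_const hΓ] at eq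
  exact eq_sub_of_add_eq eq

theorem connCurvature_of_semiconj {Γ : E → E →L[ℝ] E →L[ℝ] E}
    {Γ' : E' → E' →L[ℝ] E' →L[ℝ] E'} {F : E → E'} {y : E} (hF : ContDiffAt ℝ 3 F y)
    (hΓ : DifferentiableAt ℝ Γ y) (hΓ' : DifferentiableAt ℝ Γ' (F y))
    (h : ∀ᶠ z in nhds y, ∀ u v, fderiv ℝ F z (Γ z u v)
      = Γ' (F z) (fderiv ℝ F z u) (fderiv ℝ F z v) + fderiv ℝ (fderiv ℝ F) z u v) (u v w : E) :
    fderiv ℝ F y (connCurvature Γ y u v w)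
      = connCurvature Γ' (F y) (fderiv ℝ F y u) (fderiv ℝ F y v) (fderiv ℝ F y w) := by
  simp only [connCurvature_apply, map_sub, map_add,
    fderiv_christoffel_of_semiconj hF hΓ hΓ' h, h.self_of_nhds]
  rw [fderiv_fderiv_comm (hF.of_le (by norm_num)) v u,
    fderiv_fderiv_comm (hF.fderiv_right (by norm_num)) v u]
  abel

variable [FiniteDimensional ℝ E] [FiniteDimensional ℝ E']

/-- The Ricci contraction of a curvature tensor: the trace of `u ↦ R(u, v) w`, bilinear
in `v` and `w`. -/
def ricciContraction (R : E →L[ℝ] E →L[ℝ] E →L[ℝ] E) : E →L[ℝ] E →L[ℝ] ℝ :=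
  ContinuousLinearMap.compL ℝ E (E →L[ℝ] E) ℝ (endTrace E)
    ∘L (ContinuousLinearMap.flipₗᵢ ℝ E E E).toContinuousLinearEquiv.toContinuousLinearMap ∘L R.flip

theorem ricciContraction_apply (R : E →L[ℝ] E →L[ℝ] E →L[ℝ] E) (v w : E) :
    ricciContraction R v w = endTrace E ((R.flip v).flip w) := rfl

theorem ricciContraction_of_semiconj {R : E →L[ℝ] E →L[ℝ] E →L[ℝ] E}
    {R' : E' →L[ℝ] E' →L[ℝ] E' →L[ℝ] E'} (A : E ≃L[ℝ] E')
    (h : ∀ u v w, A (R u v w) = R' (A u) (A v) (A w)) (v w : E) :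
    ricciContraction R v w = ricciContraction R' (A v) (A w) :=
  endTrace_eq_of_semiconj A fun u => h u v w

end Connections

section LeviCivita

variable {n : ℕ} {g : Model n → Model n →L[ℝ] Model n →L[ℝ] ℝ} {y : Model n}

/-- Near `y`, the field `g` of bilinear forms is a pseudo-Riemannian metric of class `C²`. -/
structure IsMetricAt (g : Model n → Model n →L[ℝ] Model n →L[ℝ] ℝ) (y : Model n) : Prop where
  contDiffAt : ContDiffAt ℝ 2 g y
  symm : ∀ᶠ z in nhds y, ∀ u v, g z u v = g z v u
  isInvertible : (g y).IsInvertible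

namespace IsMetricAt

theorem eventually (hg : IsMetricAt g y) : ∀ᶠ z in nhds y, IsMetricAt g z := by
  have invertible : ∀ᶠ z in nhds y, (g z).IsInvertible :=
    hg.contDiffAt.continuousAt.eventually
      (ContinuousLinearEquiv.isOpen.mem_nhds hg.isInvertible)
  filter_upwards [hg.contDiffAt.eventually (by simp), hg.symm.eventually_nhds, invertible]
    with z h₁ h₂ h₃ using ⟨h₁, h₂, h₃⟩

theorem congr {h : Model n → Model n →L[ℝ] Model n →L[ℝ] ℝ} (hg : IsMetricAt g y)
    (e : h =ᶠ[nhds y] g) : IsMetricAt h y where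
  contDiffAt := hg.contDiffAt.congr_of_eventuallyEq e
  symm := by filter_upwards [hg.symm, e] with z hz ez using by simpa only [ez] using hz
  isInvertible := e.self_of_nhds ▸ hg.isInvertible

theorem differentiableAt (hg : IsMetricAt g y) : DifferentiableAt ℝ g y :=
  hg.contDiffAt.differentiableAt two_ne_zero

theorem apply_comm (hg : IsMetricAt g y) (u v : Model n) : g y u v = g y v u :=
  hg.symm.self_of_nhds u v

theorem koszul (hg : IsMetricAt g y) (u v w : Model n) :
    g y (christoffel g y u v) w
      = (fderiv ℝ g y u v w + fderiv ℝ g y v u w - fderiv ℝ g y w u v) / 2 := by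
  rw [christoffel, hg.isInvertible.self_apply_inverse]
  simp only [_root_.smul_apply, _root_.sub_apply, _root_.add_apply,
    ContinuousLinearMap.flip_apply, smul_eq_mul]
  ring

theorem fderiv_symm (hg : IsMetricAt g y) (u v w : Model n) :
    fderiv ℝ g y u v w = fderiv ℝ g y u w v := by
  have e : (fun z => g z v w) =ᶠ[nhds y] fun z => g z w v := hg.symm.mono fun z hz => hz v w
  simpa only [fderiv_bilin_apply_const hg.differentiableAt] using
    congrArg (fun l => l u) (Filter.EventuallyEq.fderiv_eq (𝕜 := ℝ) e)

theorem christoffel_symm (hg : IsMetricAt g y) (u v : Model n) :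
    christoffel g y u v = christoffel g y v u := by
  refine ext_of_isInvertible hg.isInvertible fun w => ?_
  rw [hg.koszul, hg.koszul, hg.fderiv_symm w u v]
  ring

theorem fderiv_eq (hg : IsMetricAt g y) (u v w : Model n) :
    fderiv ℝ g y u v w = g y (christoffel g y u v) w + g y v (christoffel g y u w) := by
  rw [hg.apply_comm v, hg.koszul, hg.koszul, hg.fderiv_symm u w v, hg.fderiv_symm w u v,
    hg.fderiv_symm v u w]
  ring

theorem eq_christoffel (hg : IsMetricAt g y) {T : Model n → Model n → Model n}
    (symm : ∀ u v, T u v = T v u)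
    (compat : ∀ u v w, fderiv ℝ g y u v w = g y (T u v) w + g y v (T u w)) (u v : Model n) :
    T u v = christoffel g y u v := by
  refine ext_of_isInvertible hg.isInvertible fun w => ?_
  rw [hg.koszul, compat, compat, compat, hg.apply_comm v, hg.apply_comm u (T v w),
    hg.apply_comm u (T w v), symm v u, symm w u, symm w v]
  ring

end IsMetricAt

/-- The trilinear form `(u, v, w) ↦ T u v w + T v u w - T w u v` of the Koszul formula. -/
def koszulForm {E : Type*} [NormedAddCommGroup E] [NormedSpace ℝ E]
    (T : E →L[ℝ] E →L[ℝ] E →L[ℝ] ℝ) : E →L[ℝ] E →L[ℝ] E →L[ℝ] ℝ :=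
  T + T.flip - (ContinuousLinearMap.flipₗᵢ ℝ E E ℝ).toContinuousLinearEquiv.toContinuousLinearMap
    ∘L T.flip

/-- The Christoffel symbols of `g` as a field of bilinear maps. -/
def leviCivita (g : Model n → Model n →L[ℝ] Model n →L[ℝ] ℝ) (y : Model n) :
    Model n →L[ℝ] Model n →L[ℝ] Model n :=
  ContinuousLinearMap.compL ℝ (Model n) (Model n →L[ℝ] ℝ) (Model n) (g y).inverse
    ∘L ((1 / 2 : ℝ) • koszulForm (fderiv ℝ g y))

theorem leviCivita_apply (g : Model n → Model n →L[ℝ] Model n →L[ℝ] ℝ) (y u v : Model n) :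
    leviCivita g y u v = christoffel g y u v := rfl

theorem IsMetricAt.contDiffAt_inverse (hg : IsMetricAt g y) :
    ContDiffAt ℝ 2 (fun z => (g z).inverse) y :=
  hg.isInvertible.contDiffAt_map_inverse.comp y hg.contDiffAt

theorem IsMetricAt.differentiableAt_leviCivita (hg : IsMetricAt g y) :
    DifferentiableAt ℝ (leviCivita g) y := by
  have dg : ContDiffAt ℝ 1 (fderiv ℝ g) y := hg.contDiffAt.fderiv_right (by norm_num)
  have koszul : ContDiffAt ℝ 1 (fun z => (1 / 2 : ℝ) • koszulForm (fderiv ℝ g z)) y := by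
    refine contDiffAt_bilin_apply.2 fun u v => contDiffAt_clm_apply.2 fun w => ?_
    have dg_apply (u v w : Model n) : ContDiffAt ℝ 1 (fun z => fderiv ℝ g z u v w) y :=
      contDiffAt_clm_apply.1 (contDiffAt_bilin_apply.1 dg u v) w
    exact (((dg_apply u v w).add (dg_apply v u w)).sub (dg_apply w u v)).const_smul (1 / 2 : ℝ)
  refine ContDiffAt.differentiableAt (contDiffAt_bilin_apply.2 fun u v => ?_) one_ne_zero
  exact (hg.contDiffAt_inverse.of_le one_le_two).clm_apply (contDiffAt_bilin_apply.1 koszul u v)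

theorem IsMetricAt.curvature_eq (hg : IsMetricAt g y) (u v w : Model n) :
    curvature g y u v w = connCurvature (leviCivita g) y u v w := by
  simp only [curvature, ← leviCivita_apply,
    fderiv_bilin_apply_const hg.differentiableAt_leviCivita, connCurvature_apply]

theorem IsMetricAt.localScalarCurvature_eq (hg : IsMetricAt g y) :
    localScalarCurvature g y
      = metricTrace (g y) fun v w => ricciContraction (connCurvature (leviCivita g) y) v w := by
  refine congrArg (metricTrace (g y)) (funext₂ fun v w => ?_)
  simp only [ricci, ricciContraction_apply, endTrace_eq_sum, hg.curvature_eq,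
    ContinuousLinearMap.flip_apply]

variable {F : Type*} [NormedAddCommGroup F] [NormedSpace ℝ F]

/-- The Hessian `∇df` of a vector-valued function as a bilinear map. -/
def hessianForm (g : Model n → Model n →L[ℝ] Model n →L[ℝ] ℝ) (f : Model n → F) (y : Model n) :
    Model n →L[ℝ] Model n →L[ℝ] F :=
  fderiv ℝ (fderiv ℝ f) y
    - ContinuousLinearMap.compL ℝ (Model n) (Model n) F (fderiv ℝ f y) ∘L leviCivita g y

theorem hessianForm_apply (g : Model n → Model n →L[ℝ] Model n →L[ℝ] ℝ) (f : Model n → F)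
    (y u v : Model n) : hessianForm g f y u v
      = fderiv ℝ (fderiv ℝ f) y u v - fderiv ℝ f y (christoffel g y u v) := rfl

theorem localLaplacian_eq (g : Model n → Model n →L[ℝ] Model n →L[ℝ] ℝ) (f : Model n → ℂ)
    (y : Model n) : localLaplacian g f y = metricTrace (g y) fun u v => hessianForm g f y u v :=
  rfl

end LeviCivita

section Pullback

variable {n : ℕ} {g : Model n → Model n →L[ℝ] Model n →L[ℝ] ℝ} {F : Model n → Model n}
  {y : Model n}

/-- The map `F` is of class `C³` at `y` and its derivative there is invertible. -/
structure IsLocalDiffeoAt (F : Model n → Model n) (y : Model n) : Prop where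
  contDiffAt : ContDiffAt ℝ 3 F y
  isInvertible : (fderiv ℝ F y).IsInvertible

/-- The pull-back `F^* g` of a field of bilinear forms. -/
def pullbackMetric (g : Model n → Model n →L[ℝ] Model n →L[ℝ] ℝ) (F : Model n → Model n)
    (z : Model n) : Model n →L[ℝ] Model n →L[ℝ] ℝ :=
  (g (F z)).bilinearComp (fderiv ℝ F z) (fderiv ℝ F z)

theorem pullbackMetric_apply (g : Model n → Model n →L[ℝ] Model n →L[ℝ] ℝ)
    (F : Model n → Model n) (z u v : Model n) :
    pullbackMetric g F z u v = g (F z) (fderiv ℝ F z u) (fderiv ℝ F z v) := rfl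

namespace IsLocalDiffeoAt

theorem differentiableAt (hF : IsLocalDiffeoAt F y) : DifferentiableAt ℝ F y :=
  hF.contDiffAt.differentiableAt three_ne_zero

theorem contDiffAt_fderiv (hF : IsLocalDiffeoAt F y) : ContDiffAt ℝ 2 (fderiv ℝ F) y :=
  hF.contDiffAt.fderiv_right (by norm_num)

theorem differentiableAt_fderiv (hF : IsLocalDiffeoAt F y) : DifferentiableAt ℝ (fderiv ℝ F) y :=
  hF.contDiffAt_fderiv.differentiableAt two_ne_zero

theorem eventually (hF : IsLocalDiffeoAt F y) : ∀ᶠ z in nhds y, IsLocalDiffeoAt F z := by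
  have invertible : ∀ᶠ z in nhds y, (fderiv ℝ F z).IsInvertible :=
    hF.contDiffAt_fderiv.continuousAt.eventually
      (ContinuousLinearEquiv.isOpen.mem_nhds hF.isInvertible)
  filter_upwards [hF.contDiffAt.eventually (by simp), invertible] with z h₁ h₂ using ⟨h₁, h₂⟩

end IsLocalDiffeoAt

theorem IsMetricAt.pullback (hg : IsMetricAt g (F y)) (hF : IsLocalDiffeoAt F y) :
    IsMetricAt (pullbackMetric g F) y where
  contDiffAt := by
    have gF : ContDiffAt ℝ 2 (fun z => g (F z)) y :=
      hg.contDiffAt.comp y (hF.contDiffAt.of_le (by norm_num))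
    have dF (u : Model n) := contDiffAt_clm_apply.1 hF.contDiffAt_fderiv u
    exact contDiffAt_bilin_apply.2 fun u v => (gF.clm_apply (dF u)).clm_apply (dF v)
  symm := (hF.contDiffAt.continuousAt.eventually hg.symm).mono fun z hz u v => hz _ _
  isInvertible := isInvertible_bilinearComp hg.isInvertible hF.isInvertible

theorem IsMetricAt.fderiv_pullbackMetric (hg : IsMetricAt g (F y)) (hF : IsLocalDiffeoAt F y)
    (u v w : Model n) : fderiv ℝ (pullbackMetric g F) y u v w
      = fderiv ℝ g (F y) (fderiv ℝ F y u) (fderiv ℝ F y v) (fderiv ℝ F y w)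
        + g (F y) (fderiv ℝ (fderiv ℝ F) y u v) (fderiv ℝ F y w)
        + g (F y) (fderiv ℝ F y v) (fderiv ℝ (fderiv ℝ F) y u w) := by
  have dF := hF.differentiableAt_fderiv
  have gF : DifferentiableAt ℝ (fun z => g (F z)) y :=
    hg.differentiableAt.fun_comp' y hF.differentiableAt
  rw [← fderiv_bilin_apply_const (hg.pullback hF).differentiableAt]
  simp only [pullbackMetric_apply]
  rw [fderiv_bilin_apply gF (by fun_prop) (by fun_prop),
    fderiv_fun_comp y hg.differentiableAt hF.differentiableAt, fderiv_clm_apply_const dF,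
    fderiv_clm_apply_const dF]
  rfl

theorem IsMetricAt.christoffel_pullbackMetric (hg : IsMetricAt g (F y))
    (hF : IsLocalDiffeoAt F y) (u v : Model n) :
    fderiv ℝ F y (christoffel (pullbackMetric g F) y u v)
      = christoffel g (F y) (fderiv ℝ F y u) (fderiv ℝ F y v)
        + fderiv ℝ (fderiv ℝ F) y u v := by
  have inv := hF.isInvertible.self_apply_inverse
  rw [← (hg.pullback hF).eq_christoffel (T := fun u v => (fderiv ℝ F y).inverse
    (christoffel g (F y) (fderiv ℝ F y u) (fderiv ℝ F y v) + fderiv ℝ (fderiv ℝ F) y u v))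
    (fun u v => ?_) (fun u v w => ?_), inv]
  · rw [hg.christoffel_symm, fderiv_fderiv_comm (hF.contDiffAt.of_le (by norm_num))]
  · rw [hg.fderiv_pullbackMetric hF, pullbackMetric_apply, pullbackMetric_apply, inv, inv,
      hg.fderiv_eq, map_add, map_add, _root_.add_apply]
    ring

theorem IsMetricAt.localScalarCurvature_pullbackMetric (hg : IsMetricAt g (F y))
    (hF : IsLocalDiffeoAt F y) :
    localScalarCurvature (pullbackMetric g F) y = localScalarCurvature g (F y) := by
  have law : ∀ᶠ z in nhds y, ∀ u v, fderiv ℝ F z (leviCivita (pullbackMetric g F) z u v)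
      = leviCivita g (F z) (fderiv ℝ F z u) (fderiv ℝ F z v) + fderiv ℝ (fderiv ℝ F) z u v := by
    filter_upwards [hF.contDiffAt.continuousAt.eventually hg.eventually, hF.eventually]
      with z hgz hFz u v using hgz.christoffel_pullbackMetric hFz u v
  have curv := connCurvature_of_semiconj hF.contDiffAt
    (hg.pullback hF).differentiableAt_leviCivita hg.differentiableAt_leviCivita law
  obtain ⟨A, hA⟩ := hF.isInvertible
  rw [(hg.pullback hF).localScalarCurvature_eq, hg.localScalarCurvature_eq,
    ← metricTrace_bilinearComp hg.isInvertible hF.isInvertible]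
  rw [← hA] at curv ⊢
  refine congrArg₂ metricTrace (by rw [hA]; rfl) (funext₂ fun v w => ?_)
  exact ricciContraction_of_semiconj A curv v w

theorem IsMetricAt.localLaplacian_pullbackMetric (hg : IsMetricAt g (F y))
    (hF : IsLocalDiffeoAt F y) {f : Model n → ℂ} (hf : ContDiffAt ℝ 2 f (F y)) :
    localLaplacian (pullbackMetric g F) (f ∘ F) y = localLaplacian g f (F y) := by
  have hess (u v : Model n) : hessianForm (pullbackMetric g F) (f ∘ F) y u v
      = hessianForm g f (F y) (fderiv ℝ F y u) (fderiv ℝ F y v) := by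
    have df : fderiv ℝ (f ∘ F) =ᶠ[nhds y] fun z => fderiv ℝ f (F z) ∘L fderiv ℝ F z := by
      filter_upwards [hF.contDiffAt.continuousAt.eventually (hf.eventually (by simp)),
        hF.eventually] with z hfz hFz
      exact fderiv_comp z (hfz.differentiableAt two_ne_zero) hFz.differentiableAt
    have ddf := differentiableAt_fderiv hf
    rw [hessianForm_apply, hessianForm_apply, df.fderiv_eq, df.self_of_nhds,
      fderiv_clm_comp (ddf.fun_comp' y hF.differentiableAt) hF.differentiableAt_fderiv,
      fderiv_fun_comp y ddf hF.differentiableAt, ContinuousLinearMap.comp_apply,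
      hg.christoffel_pullbackMetric hF, map_add]
    simp only [_root_.add_apply, ContinuousLinearMap.comp_apply, ContinuousLinearMap.compL_apply,
      ContinuousLinearMap.flip_apply]
    ring
  rw [localLaplacian_eq, localLaplacian_eq,
    ← metricTrace_bilinearComp hg.isInvertible hF.isInvertible]
  exact congrArg (metricTrace _) (funext₂ hess)

end Pullback

section ConformalDifference

variable {E : Type*} [NormedAddCommGroup E] [NormedSpace ℝ E]
  {a : E →L[ℝ] ℝ} {b : E →L[ℝ] E →L[ℝ] ℝ} {X : E}

/-- The tensor `(u, v) ↦ a(u) v + a(v) u - b(u, v) X`; for `a = dφ`, `b = g`, `X = ∇φ` it is the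
difference of the Levi-Civita connections of `e^{2φ} g` and `g`. -/
def conformalDifference (a : E →L[ℝ] ℝ) (b : E →L[ℝ] E →L[ℝ] ℝ) (X : E) :
    E →L[ℝ] E →L[ℝ] E :=
  (ContinuousLinearMap.smulRightL ℝ E E a).flip + ContinuousLinearMap.smulRightL ℝ E E a
    - (ContinuousLinearMap.smulRightL ℝ E E).flip X ∘L b

theorem conformalDifference_apply (a : E →L[ℝ] ℝ) (b : E →L[ℝ] E →L[ℝ] ℝ) (X u v : E) :
    conformalDifference a b X u v = a u • v + a v • u - b u v • X := rfl

theorem conformalDifference_comm (hb : ∀ u v, b u v = b v u) (hX : ∀ v, b X v = a v) (u v w : E) :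
    conformalDifference a b X u (conformalDifference a b X v w)
        - conformalDifference a b X v (conformalDifference a b X u w)
      = (a v * a w) • u - (a u * a w) • v - a X • (b v w • u - b u w • v)
        + (b v w * a u - b u w * a v) • X := by
  simp only [conformalDifference_apply, map_add, map_sub, map_smul, hb _ X, hX, hb v u]
  module

theorem ricciContraction_of_eq_add [FiniteDimensional ℝ E] {R R' : E →L[ℝ] E →L[ℝ] E →L[ℝ] E}
    {Q : E →L[ℝ] E}
    (h : ∀ u v w, R' u v w
      = R u v w + (b (Q u) w • v + b u w • Q v - b (Q v) w • u - b v w • Q u)) (v w : E) :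
    ricciContraction R' v w = ricciContraction R v w
      - ((Module.finrank ℝ E : ℝ) - 2) * b (Q v) w - endTrace E Q * b v w := by
  have op : (R'.flip v).flip w = (R.flip v).flip w
      + ((b.flip w ∘L Q).smulRight v + (b.flip w).smulRight (Q v)
        - b (Q v) w • ContinuousLinearMap.id ℝ E - b v w • Q) :=
    ContinuousLinearMap.ext fun u => h u v w
  simp only [ricciContraction_apply, op, map_add, map_sub, map_smul, endTrace_smulRight,
    endTrace_id, ContinuousLinearMap.comp_apply, ContinuousLinearMap.flip_apply, smul_eq_mul]
  ring

end ConformalDifference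

section ConformalChange

variable {n : ℕ} {g : Model n → Model n →L[ℝ] Model n →L[ℝ] ℝ} {φ : Model n → ℝ} {y : Model n}

/-- The gradient of a function. -/
def grad (g : Model n → Model n →L[ℝ] Model n →L[ℝ] ℝ) (φ : Model n → ℝ) (y : Model n) :
    Model n :=
  (g y).inverse (fderiv ℝ φ y)

/-- The covariant derivative `u ↦ ∇ᵤ ∇φ` of the gradient. -/
def gradDeriv (g : Model n → Model n →L[ℝ] Model n →L[ℝ] ℝ) (φ : Model n → ℝ) (y : Model n) :
    Model n →L[ℝ] Model n :=
  fderiv ℝ (grad g φ) y + (leviCivita g y).flip (grad g φ y)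

theorem gradDeriv_apply (g : Model n → Model n →L[ℝ] Model n →L[ℝ] ℝ) (φ : Model n → ℝ)
    (y u : Model n) :
    gradDeriv g φ y u = fderiv ℝ (grad g φ) y u + christoffel g y u (grad g φ y) := rfl

/-- The Laplacian of a real function. -/
def laplacianReal (g : Model n → Model n →L[ℝ] Model n →L[ℝ] ℝ) (φ : Model n → ℝ)
    (y : Model n) : ℝ :=
  metricTrace (g y) fun u v => hessianForm g φ y u v

/-- The squared length of the gradient. -/
def gradSq (g : Model n → Model n →L[ℝ] Model n →L[ℝ] ℝ) (φ : Model n → ℝ) (y : Model n) : ℝ :=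
  fderiv ℝ φ y (grad g φ y)

/-- The conformal metric `e^{2φ} g`. -/
def conformalChange (g : Model n → Model n →L[ℝ] Model n →L[ℝ] ℝ) (φ : Model n → ℝ)
    (z : Model n) : Model n →L[ℝ] Model n →L[ℝ] ℝ :=
  Real.exp (2 * φ z) • g z

/-- The endomorphism `∇∇φ - dφ ⊗ ∇φ + |∇φ|² / 2`, through which the curvatures of `g` and
`e^{2φ} g` differ (the difference of their Schouten tensors, up to sign). -/
def schoutenChange (g : Model n → Model n →L[ℝ] Model n →L[ℝ] ℝ) (φ : Model n → ℝ)
    (y : Model n) : Model n →L[ℝ] Model n :=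
  gradDeriv g φ y - (fderiv ℝ φ y).smulRight (grad g φ y)
    + (gradSq g φ y / 2) • ContinuousLinearMap.id ℝ (Model n)

theorem schoutenChange_apply (g : Model n → Model n →L[ℝ] Model n →L[ℝ] ℝ) (φ : Model n → ℝ)
    (y u : Model n) : schoutenChange g φ y u
      = gradDeriv g φ y u - fderiv ℝ φ y u • grad g φ y + (gradSq g φ y / 2) • u := rfl

namespace IsMetricAt

theorem apply_grad (hg : IsMetricAt g y) (v : Model n) : g y (grad g φ y) v = fderiv ℝ φ y v := by
  rw [grad, hg.isInvertible.self_apply_inverse]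

theorem differentiableAt_grad (hg : IsMetricAt g y) (hφ : ContDiffAt ℝ 2 φ y) :
    DifferentiableAt ℝ (grad g φ) y :=
  (hg.contDiffAt_inverse.differentiableAt two_ne_zero).clm_apply (differentiableAt_fderiv hφ)

theorem hessianForm_symm (hg : IsMetricAt g y) (hφ : ContDiffAt ℝ 2 φ y) (u v : Model n) :
    hessianForm g φ y u v = hessianForm g φ y v u := by
  rw [hessianForm_apply, hessianForm_apply, hg.christoffel_symm, fderiv_fderiv_comm hφ]

theorem apply_gradDeriv (hg : IsMetricAt g y) (hφ : ContDiffAt ℝ 2 φ y) (u w : Model n) :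
    g y (gradDeriv g φ y u) w = hessianForm g φ y u w := by
  have e : (fun z => g z (grad g φ z) w) =ᶠ[nhds y] fun z => fderiv ℝ φ z w :=
    hg.eventually.mono fun z hz => hz.apply_grad w
  have deriv := congrArg (fun l => l u) (Filter.EventuallyEq.fderiv_eq (𝕜 := ℝ) e)
  rw [fderiv_bilin_apply hg.differentiableAt (hg.differentiableAt_grad hφ)
    (differentiableAt_const w), fderiv_clm_apply_const (differentiableAt_fderiv hφ),
    fderiv_fun_const, hg.fderiv_eq, hg.apply_grad] at deriv
  rw [hessianForm_apply, ← deriv, gradDeriv_apply, map_add, _root_.add_apply]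
  simp only [Pi.zero_apply, _root_.zero_apply, map_zero]
  ring

theorem endTrace_gradDeriv (hg : IsMetricAt g y) (hφ : ContDiffAt ℝ 2 φ y) :
    endTrace (Model n) (gradDeriv g φ y) = laplacianReal g φ y :=
  (metricTrace_eq_endTrace hg.isInvertible _ fun u v => by
    rw [hg.apply_comm, hg.apply_gradDeriv hφ, hg.hessianForm_symm hφ]).symm

theorem apply_schoutenChange (hg : IsMetricAt g y) (hφ : ContDiffAt ℝ 2 φ y) (u w : Model n) :
    g y (schoutenChange g φ y u) w = hessianForm g φ y u w - fderiv ℝ φ y u * fderiv ℝ φ y w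
      + gradSq g φ y / 2 * g y u w := by
  simp only [schoutenChange_apply, map_add, map_sub, map_smul, _root_.add_apply,
    _root_.sub_apply, _root_.smul_apply, hg.apply_gradDeriv hφ, hg.apply_grad, smul_eq_mul]

theorem endTrace_schoutenChange (hg : IsMetricAt g y) (hφ : ContDiffAt ℝ 2 φ y) :
    endTrace (Model n) (schoutenChange g φ y)
      = laplacianReal g φ y + ((n : ℝ) - 2) / 2 * gradSq g φ y := by
  simp only [schoutenChange, map_add, map_sub, map_smul, hg.endTrace_gradDeriv hφ,
    endTrace_smulRight, endTrace_id, finrank_euclideanSpace_fin, smul_eq_mul]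
  rw [← gradSq]
  ring

theorem metricTrace_schoutenChange (hg : IsMetricAt g y) (hφ : ContDiffAt ℝ 2 φ y) :
    metricTrace (g y) (fun u v => g y (schoutenChange g φ y u) v)
      = endTrace (Model n) (schoutenChange g φ y) :=
  metricTrace_eq_endTrace hg.isInvertible _ fun u v => by
    rw [hg.apply_comm u, hg.apply_schoutenChange hφ, hg.apply_schoutenChange hφ,
      hg.hessianForm_symm hφ, hg.apply_comm u v, mul_comm (fderiv ℝ φ y u)]

theorem conformal (hg : IsMetricAt g y) (hφ : ContDiffAt ℝ 2 φ y) :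
    IsMetricAt (conformalChange g φ) y where
  contDiffAt := (contDiffAt_const.mul hφ).exp.smul hg.contDiffAt
  symm := hg.symm.mono fun z hz u v => congrArg (Real.exp (2 * φ z) * ·) (hz u v)
  isInvertible := isInvertible_const_smul hg.isInvertible (Real.exp_pos _).ne'

theorem fderiv_conformalChange (hg : IsMetricAt g y) (hφ : DifferentiableAt ℝ φ y)
    (u v w : Model n) : fderiv ℝ (conformalChange g φ) y u v w
      = Real.exp (2 * φ y) * (fderiv ℝ g y u v w + 2 * fderiv ℝ φ y u * g y v w) := by
  have d := (hφ.hasFDerivAt.const_mul 2).exp.fun_smul hg.differentiableAt.hasFDerivAt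
  rw [show fderiv ℝ (conformalChange g φ) y = _ from d.fderiv]
  simp only [_root_.add_apply, _root_.smul_apply, ContinuousLinearMap.smulRight_apply, smul_eq_mul]
  ring

theorem leviCivita_conformalChange (hg : IsMetricAt g y) (hφ : ContDiffAt ℝ 2 φ y) :
    leviCivita (conformalChange g φ) y
      = leviCivita g y + conformalDifference (fderiv ℝ φ y) (g y) (grad g φ y) := by
  ext1 u
  ext1 v
  refine ((hg.conformal hφ).eq_christoffel (T := fun u v =>
    (leviCivita g y + conformalDifference (fderiv ℝ φ y) (g y) (grad g φ y)) u v) ?_ ?_ u v).symm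
  · intro u v
    simp only [_root_.add_apply, leviCivita_apply, conformalDifference_apply,
      hg.christoffel_symm u v, hg.apply_comm u v, add_comm (fderiv ℝ φ y u • v)]
  · intro u v w
    rw [hg.fderiv_conformalChange (hφ.differentiableAt two_ne_zero), hg.fderiv_eq]
    simp only [conformalChange, _root_.add_apply, _root_.sub_apply,
      _root_.smul_apply, leviCivita_apply, conformalDifference_apply, map_add, map_sub, map_smul,
      hg.apply_grad, hg.apply_comm _ (grad g φ y), hg.apply_comm v u, smul_eq_mul]
    ring

theorem differentiableAt_conformalDifference (hg : IsMetricAt g y) (hφ : ContDiffAt ℝ 2 φ y) :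
    DifferentiableAt ℝ (fun z => conformalDifference (fderiv ℝ φ z) (g z) (grad g φ z)) y := by
  let S := ContinuousLinearMap.smulRightL ℝ (Model n) (Model n)
  have dS : DifferentiableAt ℝ (fun z => S (fderiv ℝ φ z)) y :=
    S.differentiableAt.comp y (differentiableAt_fderiv hφ)
  have dX : DifferentiableAt ℝ (fun z => S.flip (grad g φ z)) y :=
    S.flip.differentiableAt.comp y (hg.differentiableAt_grad hφ)
  have dflip := (ContinuousLinearMap.flipₗᵢ ℝ (Model n) (Model n)
    (Model n)).toContinuousLinearEquiv.differentiableAt.comp y dS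
  exact (dflip.add dS).sub (dX.clm_comp hg.differentiableAt)

theorem covDeriv_conformalDifference (hg : IsMetricAt g y) (hφ : ContDiffAt ℝ 2 φ y)
    (u v w : Model n) :
    covDeriv (leviCivita g) (fun z => conformalDifference (fderiv ℝ φ z) (g z) (grad g φ z)) y u v w
      = hessianForm g φ y u v • w + hessianForm g φ y u w • v - g y v w • gradDeriv g φ y u := by
  have dφ := differentiableAt_fderiv hφ
  have dg := hg.differentiableAt
  have dX := hg.differentiableAt_grad hφ
  have deriv : fderiv ℝ (fun z => conformalDifference (fderiv ℝ φ z) (g z) (grad g φ z)) y u v w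
      = fderiv ℝ (fderiv ℝ φ) y u v • w + fderiv ℝ (fderiv ℝ φ) y u w • v
        - (g y v w • fderiv ℝ (grad g φ) y u + fderiv ℝ g y u v w • grad g φ y) := by
    rw [← fderiv_bilin_apply_const (hg.differentiableAt_conformalDifference hφ)]
    simp only [conformalDifference_apply]
    rw [fderiv_fun_sub (by fun_prop) (by fun_prop), fderiv_fun_add (by fun_prop) (by fun_prop),
      fderiv_smul_const (by fun_prop), fderiv_smul_const (by fun_prop),
      fderiv_fun_smul (by fun_prop) dX]
    simp only [_root_.add_apply, _root_.sub_apply, _root_.smul_apply,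
      ContinuousLinearMap.smulRight_apply, fderiv_clm_apply_const dφ, fderiv_bilin_apply_const dg]
  simp only [covDeriv, deriv, conformalDifference_apply, hessianForm_apply, gradDeriv_apply,
    leviCivita_apply, hg.fderiv_eq, map_add, map_sub, map_smul]
  module

theorem connCurvature_conformalChange (hg : IsMetricAt g y) (hφ : ContDiffAt ℝ 2 φ y)
    (u v w : Model n) :
    connCurvature (leviCivita (conformalChange g φ)) y u v w
      = connCurvature (leviCivita g) y u v w
        + (g y (schoutenChange g φ y u) w • v + g y u w • schoutenChange g φ y v
          - g y (schoutenChange g φ y v) w • u - g y v w • schoutenChange g φ y u) := by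
  have e : leviCivita (conformalChange g φ) =ᶠ[nhds y]
      leviCivita g + fun z => conformalDifference (fderiv ℝ φ z) (g z) (grad g φ z) := by
    filter_upwards [hg.eventually, hφ.eventually (by simp)] with z hgz hφz
      using hgz.leviCivita_conformalChange hφz
  have curv : connCurvature (leviCivita (conformalChange g φ)) y = connCurvature (leviCivita g
      + fun z => conformalDifference (fderiv ℝ φ z) (g z) (grad g φ z)) y := by
    rw [connCurvature, e.fderiv_eq, e.self_of_nhds, ← connCurvature]
  rw [curv, connCurvature_add_apply hg.differentiableAt_leviCivita
    (hg.differentiableAt_conformalDifference hφ) hg.christoffel_symm,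
    hg.covDeriv_conformalDifference hφ, hg.covDeriv_conformalDifference hφ,
    conformalDifference_comm hg.apply_comm hg.apply_grad, hg.apply_schoutenChange hφ,
    hg.apply_schoutenChange hφ, schoutenChange_apply, schoutenChange_apply,
    hg.hessianForm_symm hφ v u]
  rw [← gradSq]
  module

theorem localScalarCurvature_conformalChange (hg : IsMetricAt g y) (hφ : ContDiffAt ℝ 2 φ y) :
    localScalarCurvature (conformalChange g φ) y
      = (Real.exp (2 * φ y))⁻¹ * (localScalarCurvature g y
        - 2 * ((n : ℝ) - 1) * (laplacianReal g φ y + ((n : ℝ) - 2) / 2 * gradSq g φ y)) := by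
  have ricci (v w : Model n) :
      ricciContraction (connCurvature (leviCivita (conformalChange g φ)) y) v w
        = ricciContraction (connCurvature (leviCivita g) y) v w
          + -((n : ℝ) - 2) * g y (schoutenChange g φ y v) w
          + -endTrace (Model n) (schoutenChange g φ y) * g y v w := by
    rw [ricciContraction_of_eq_add (hg.connCurvature_conformalChange hφ),
      finrank_euclideanSpace_fin]
    ring
  rw [(hg.conformal hφ).localScalarCurvature_eq, conformalChange,
    metricTrace_const_smul hg.isInvertible (Real.exp_pos _).ne', smul_eq_mul]
  simp only [ricci, metricTrace_add, metricTrace_mul_left, ← hg.localScalarCurvature_eq,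
    metricTrace_self hg.isInvertible, hg.metricTrace_schoutenChange hφ,
    hg.endTrace_schoutenChange hφ]
  ring

theorem localLaplacian_conformalChange (hg : IsMetricAt g y) (hφ : ContDiffAt ℝ 2 φ y)
    (p : Model n → ℂ) :
    localLaplacian (conformalChange g φ) p y
      = ((Real.exp (2 * φ y))⁻¹ : ℝ) * (localLaplacian g p y
        + ((n : ℂ) - 2) * fderiv ℝ p y (grad g φ y)) := by
  have hess (u v : Model n) : hessianForm (conformalChange g φ) p y u v
      = hessianForm g p y u v + -1 * (fderiv ℝ φ y u • fderiv ℝ p y v)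
        + -1 * (fderiv ℝ φ y v • fderiv ℝ p y u)
        + (g y u v : ℂ) * fderiv ℝ p y (grad g φ y) := by
    rw [hessianForm_apply, ← leviCivita_apply, hg.leviCivita_conformalChange hφ]
    simp only [_root_.add_apply, conformalDifference_apply, leviCivita_apply, map_add, map_sub,
      map_smul, hessianForm_apply, Complex.real_smul]
    ring
  rw [localLaplacian_eq, conformalChange,
    metricTrace_const_smul hg.isInvertible (Real.exp_pos _).ne', Complex.real_smul]
  simp only [hess, metricTrace_add, metricTrace_mul_left, metricTrace_mul_right,
    metricTrace_ofReal, metricTrace_smul_left hg.isInvertible hg.apply_comm,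
    metricTrace_smul_right, metricTrace_self hg.isInvertible]
  rw [← localLaplacian_eq, ← grad]
  push_cast
  ring

end IsMetricAt

end ConformalChange

section YamabeCovariance

variable {n : ℕ} {g : Model n → Model n →L[ℝ] Model n →L[ℝ] ℝ} {φ : Model n → ℝ}
  {p q : Model n → ℂ} {y : Model n}

theorem hessianForm_mul (g : Model n → Model n →L[ℝ] Model n →L[ℝ] ℝ) (hq : ContDiffAt ℝ 2 q y)
    (hp : ContDiffAt ℝ 2 p y) (u v : Model n) :
    hessianForm g (fun z => q z * p z) y u v
      = q y * hessianForm g p y u v + p y * hessianForm g q y u v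
        + fderiv ℝ q y u * fderiv ℝ p y v + fderiv ℝ p y u * fderiv ℝ q y v := by
  have deriv : fderiv ℝ (fun z => q z * p z) =ᶠ[nhds y]
      fun z => q z • fderiv ℝ p z + p z • fderiv ℝ q z := by
    filter_upwards [hq.eventually (by simp), hp.eventually (by simp)] with z hqz hpz
      using fderiv_fun_mul (hqz.differentiableAt two_ne_zero) (hpz.differentiableAt two_ne_zero)
  have dq := hq.differentiableAt two_ne_zero
  have dp := hp.differentiableAt two_ne_zero
  have ddq := differentiableAt_fderiv hq
  have ddp := differentiableAt_fderiv hp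
  rw [hessianForm_apply, deriv.fderiv_eq, deriv.self_of_nhds,
    fderiv_fun_add (dq.fun_smul ddp) (dp.fun_smul ddq), fderiv_fun_smul dq ddp,
    fderiv_fun_smul dp ddq]
  simp only [hessianForm_apply, _root_.add_apply, _root_.smul_apply,
    ContinuousLinearMap.smulRight_apply, smul_eq_mul]
  ring

theorem contDiffAt_cexp_mul {m : WithTop ℕ∞} (hφ : ContDiffAt ℝ m φ y) (μ : ℂ) :
    ContDiffAt ℝ m (fun z => Complex.exp (φ z * μ)) y :=
  ((Complex.ofRealCLM.contDiff.contDiffAt.comp y hφ).mul contDiffAt_const).cexp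

theorem fderiv_cexp_mul (hφ : DifferentiableAt ℝ φ y) (μ : ℂ) :
    fderiv ℝ (fun z => Complex.exp (φ z * μ)) y
      = Complex.exp (φ y * μ) • (fderiv ℝ φ y).smulRight μ := by
  refine ((Complex.ofRealCLM.hasFDerivAt.comp y hφ.hasFDerivAt).mul_const μ).cexp.fderiv.trans ?_
  congr 1
  exact ContinuousLinearMap.ext fun u => mul_comm ..

theorem hessianForm_cexp_mul (g : Model n → Model n →L[ℝ] Model n →L[ℝ] ℝ)
    (hφ : ContDiffAt ℝ 2 φ y) (μ : ℂ) (u v : Model n) :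
    hessianForm g (fun z => Complex.exp (φ z * μ)) y u v
      = Complex.exp (φ y * μ) * (μ * hessianForm g φ y u v
        + μ ^ 2 * (fderiv ℝ φ y u * fderiv ℝ φ y v)) := by
  let L := (ContinuousLinearMap.smulRightL ℝ (Model n) ℂ).flip μ
  have deriv : fderiv ℝ (fun z => Complex.exp (φ z * μ)) =ᶠ[nhds y]
      fun z => Complex.exp (φ z * μ) • L (fderiv ℝ φ z) := by
    filter_upwards [hφ.eventually (by simp)] with z hz
      using fderiv_cexp_mul (hz.differentiableAt two_ne_zero) μ
  have dexp := (contDiffAt_cexp_mul hφ μ).differentiableAt two_ne_zero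
  have dL := L.hasFDerivAt.comp y (differentiableAt_fderiv hφ).hasFDerivAt
  have deriv₂ := (dexp.hasFDerivAt.fun_smul dL).congr_of_eventuallyEq deriv
  rw [hessianForm_apply, deriv₂.fderiv, fderiv_cexp_mul (hφ.differentiableAt two_ne_zero)]
  simp only [L, hessianForm_apply, Function.comp_apply, ContinuousLinearMap.flip_apply,
    ContinuousLinearMap.comp_apply, ContinuousLinearMap.smulRightL_apply_apply,
    ContinuousLinearMap.smulRight_apply,
    _root_.add_apply, _root_.smul_apply, smul_eq_mul, Complex.real_smul]
  push_cast
  ring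

namespace IsMetricAt

theorem localLaplacian_cexp_mul (hg : IsMetricAt g y) (hφ : ContDiffAt ℝ 2 φ y)
    (hp : ContDiffAt ℝ 2 p y) (μ : ℂ) :
    localLaplacian g (fun z => Complex.exp (φ z * μ) * p z) y
      = Complex.exp (φ y * μ) * (localLaplacian g p y + 2 * μ * fderiv ℝ p y (grad g φ y)
        + (μ * laplacianReal g φ y + μ ^ 2 * gradSq g φ y) * p y) := by
  have hess (u v : Model n) :
      hessianForm g (fun z => Complex.exp (φ z * μ) * p z) y u v
        = Complex.exp (φ y * μ) * (hessianForm g p y u v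
          + μ * (fderiv ℝ φ y u • fderiv ℝ p y v) + μ * (fderiv ℝ φ y v • fderiv ℝ p y u)
          + ((hessianForm g φ y u v : ℝ) : ℂ) * (μ * p y)
          + ((fderiv ℝ φ y u • fderiv ℝ φ y v : ℝ) : ℂ) * (μ ^ 2 * p y)) := by
    rw [hessianForm_mul g (contDiffAt_cexp_mul hφ μ) hp, hessianForm_cexp_mul g hφ,
      fderiv_cexp_mul (hφ.differentiableAt two_ne_zero)]
    simp only [ContinuousLinearMap.smulRight_apply, _root_.smul_apply, smul_eq_mul,
      Complex.real_smul]
    push_cast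
    ring
  rw [localLaplacian_eq]
  simp only [hess, metricTrace_add, metricTrace_mul_left, metricTrace_mul_right,
    metricTrace_ofReal, metricTrace_smul_left hg.isInvertible hg.apply_comm,
    metricTrace_smul_right]
  rw [← localLaplacian_eq, ← grad, ← gradSq, ← laplacianReal]
  ring

end IsMetricAt

/-- The Yamabe operator of a metric on an open subset of `ℝⁿ`. -/
def localYamabe (g : Model n → Model n →L[ℝ] Model n →L[ℝ] ℝ) (f : Model n → ℂ) (y : Model n) :
    ℂ :=
  localLaplacian g f y
    - (((n : ℝ) - 2) / (4 * ((n : ℝ) - 1)) * localScalarCurvature g y : ℝ) * f y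

theorem localYamabe_congr_metric {g' : Model n → Model n →L[ℝ] Model n →L[ℝ] ℝ}
    (hg : IsMetricAt g y) (e : g' =ᶠ[nhds y] g) (f : Model n → ℂ) :
    localYamabe g' f y = localYamabe g f y := by
  have conn : leviCivita g' =ᶠ[nhds y] leviCivita g :=
    e.eventuallyEq_nhds.mono fun z ez => by
      ext u v : 2
      rw [leviCivita_apply, leviCivita_apply, christoffel, christoffel, ez.fderiv_eq,
        ez.self_of_nhds]
  have hessian_eq : hessianForm g' f y = hessianForm g f y := by
    rw [hessianForm, hessianForm, conn.self_of_nhds]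
  rw [localYamabe, localYamabe, localLaplacian_eq, localLaplacian_eq, hessian_eq,
    hg.localScalarCurvature_eq, (hg.congr e).localScalarCurvature_eq, connCurvature, connCurvature,
    conn.fderiv_eq, conn.self_of_nhds, e.self_of_nhds]

theorem localYamabe_congr (g : Model n → Model n →L[ℝ] Model n →L[ℝ] ℝ) (e : p =ᶠ[nhds y] q) :
    localYamabe g p y = localYamabe g q y := by
  have hessian_eq : hessianForm g p y = hessianForm g q y := by
    rw [hessianForm, hessianForm, e.fderiv.fderiv_eq, e.fderiv_eq]
  rw [localYamabe, localYamabe, localLaplacian_eq, localLaplacian_eq, hessian_eq, e.self_of_nhds]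

theorem IsMetricAt.localYamabe_conformalChange (hn : (n : ℝ) ≠ 1) (hg : IsMetricAt g y)
    (hφ : ContDiffAt ℝ 2 φ y) (hp : ContDiffAt ℝ 2 p y) :
    localYamabe g (fun z => Complex.exp (φ z * (((n : ℂ) - 2) / 2)) * p z) y
      = Complex.exp (φ y * (((n : ℂ) - 2) / 2)) * (Real.exp (2 * φ y) : ℝ)
        * localYamabe (conformalChange g φ) p y := by
  rw [localYamabe, localYamabe, hg.localLaplacian_cexp_mul hφ hp,
    hg.localLaplacian_conformalChange hφ, hg.localScalarCurvature_conformalChange hφ]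
  have exp_ne : ((Real.exp (2 * φ y) : ℝ) : ℂ) ≠ 0 := by exact_mod_cast (Real.exp_pos _).ne'
  have sub_ne : (n : ℂ) - 1 ≠ 0 := sub_ne_zero.2 (by exact_mod_cast hn)
  generalize Real.exp (2 * φ y) = E at *
  push_cast
  field_simp
  ring

theorem IsMetricAt.localYamabe_pullbackMetric {F : Model n → Model n} (hg : IsMetricAt g (F y))
    (hF : IsLocalDiffeoAt F y) (hp : ContDiffAt ℝ 2 p (F y)) :
    localYamabe (pullbackMetric g F) (p ∘ F) y = localYamabe g p (F y) := by
  rw [localYamabe, localYamabe, hg.localLaplacian_pullbackMetric hF hp,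
    hg.localScalarCurvature_pullbackMetric hF, Function.comp_apply]

theorem localYamabe_covariant {g' : Model n → Model n →L[ℝ] Model n →L[ℝ] ℝ}
    {F : Model n → Model n} {Ω : Model n → ℝ} (hn : (n : ℝ) ≠ 1) (hg : IsMetricAt g y)
    (hg' : IsMetricAt g' (F y)) (hF : IsLocalDiffeoAt F y) (hΩ : ContDiffAt ℝ 2 Ω y)
    (pos : 0 < Ω y) (conf : pullbackMetric g' F =ᶠ[nhds y] fun z => Ω z ^ 2 • g z)
    (hp : ContDiffAt ℝ 2 p (F y)) :
    localYamabe g (fun z => (Ω z : ℂ) ^ (((n : ℂ) - 2) / 2) * p (F z)) y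
      = (Ω y : ℂ) ^ (((n : ℂ) - 2) / 2) * (Ω y : ℂ) ^ 2 * localYamabe g' p (F y) := by
  set φ : Model n → ℝ := fun z => Real.log (Ω z)
  have pos' : ∀ᶠ z in nhds y, 0 < Ω z := hΩ.continuousAt.eventually (lt_mem_nhds pos)
  have exp_two_mul {z : Model n} (hz : 0 < Ω z) : Real.exp (2 * φ z) = Ω z ^ 2 := by
    rw [two_mul, Real.exp_add, Real.exp_log hz, sq]
  have cpow {z : Model n} (hz : 0 < Ω z) (μ : ℂ) : (Ω z : ℂ) ^ μ = Complex.exp (φ z * μ) := by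
    rw [Complex.cpow_def_of_ne_zero (by exact_mod_cast hz.ne'), ← Complex.ofReal_log hz.le]
  have hφ : ContDiffAt ℝ 2 φ y := hΩ.log pos.ne'
  have metric : pullbackMetric g' F =ᶠ[nhds y] conformalChange g φ := by
    filter_upwards [conf, pos'] with z hz hpos
    rw [hz, conformalChange, exp_two_mul hpos]
  have twisted : (fun z => (Ω z : ℂ) ^ (((n : ℂ) - 2) / 2) * p (F z)) =ᶠ[nhds y]
      fun z => Complex.exp (φ z * (((n : ℂ) - 2) / 2)) * (p ∘ F) z := by
    filter_upwards [pos'] with z hz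
    rw [cpow hz, Function.comp_apply]
  rw [localYamabe_congr g twisted, hg.localYamabe_conformalChange hn hφ
    (hp.comp y (hF.contDiffAt.of_le (by norm_num))), exp_two_mul pos, ← cpow pos,
    ← localYamabe_congr_metric (hg.conformal hφ) metric, hg'.localYamabe_pullbackMetric hF hp]
  push_cast
  rfl

end YamabeCovariance

section Charts

variable {n : ℕ}
  {M : Type*} [TopologicalSpace M] [ChartedSpace (Model n) M]
  {N : Type*} [TopologicalSpace N] [ChartedSpace (Model n) N]
  {P : Type*} [TopologicalSpace P] [ChartedSpace (Model n) P]

/-- The derivative of a map between manifolds. Each tangent space of an `n`-manifold is the model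
space by definition; recording this in the type avoids dependent types. -/
def modelDeriv (f : M → N) (x : M) : Model n →L[ℝ] Model n := mfderiv (𝓡 n) (𝓡 n) f x

theorem modelDeriv_comp {f : M → N} {k : N → P} {x : M}
    (hk : MDifferentiableAt (𝓡 n) (𝓡 n) k (f x)) (hf : MDifferentiableAt (𝓡 n) (𝓡 n) f x) :
    modelDeriv (n := n) (k ∘ f) x = modelDeriv k (f x) ∘L modelDeriv f x :=
  mfderiv_comp x hk hf

theorem modelDeriv_id (x : M) :
    modelDeriv (n := n) (id : M → M) x = ContinuousLinearMap.id ℝ (Model n) :=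
  mfderiv_id

theorem modelDeriv_congr {f k : M → N} {x : M} (h : f =ᶠ[nhds x] k) :
    modelDeriv (n := n) f x = modelDeriv k x :=
  h.mfderiv_eq

theorem modelDeriv_eq_fderiv (f : Model n → Model n) (x : Model n) :
    modelDeriv f x = fderiv ℝ f x :=
  mfderiv_eq_fderiv

theorem modelDeriv_eq_fderiv_writtenInExtChartAt {f : M → N} {x : M}
    (hf : MDifferentiableAt (𝓡 n) (𝓡 n) f x) : modelDeriv f x
      = fderiv ℝ (writtenInExtChartAt (𝓡 n) (𝓡 n) x f) (extChartAt (𝓡 n) x x) :=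
  hf.mfderiv.trans (by rw [ModelWithCorners.range_eq_univ, fderivWithin_univ])

theorem isInvertible_modelDeriv {f : M → N} {x : M}
    (hf : IsLocalDiffeomorphAt (𝓡 n) (𝓡 n) ∞ f x) : (modelDeriv (n := n) f x).IsInvertible :=
  ⟨hf.mfderivToContinuousLinearEquiv (by simp),
    hf.mfderivToContinuousLinearEquiv_coe (by simp)⟩

theorem isLocalDiffeoAt_writtenInExtChartAt [IsManifold (𝓡 n) ∞ M] [IsManifold (𝓡 n) ∞ N]
    {Φ : M → N} {x : M} (hΦ : IsLocalDiffeomorphAt (𝓡 n) (𝓡 n) ∞ Φ x) :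
    IsLocalDiffeoAt (writtenInExtChartAt (𝓡 n) (𝓡 n) x Φ) (extChartAt (𝓡 n) x x) where
  contDiffAt := by
    have smooth := ((contMDiffAt_iff ..).1 hΦ.contMDiffAt).2
    rw [ModelWithCorners.range_eq_univ, contDiffWithinAt_univ] at smooth
    exact smooth.of_le (by norm_cast)
  isInvertible := by
    rw [← modelDeriv_eq_fderiv_writtenInExtChartAt (hΦ.mdifferentiableAt (by simp))]
    exact isInvertible_modelDeriv hΦ

theorem extChartAt_symm_comp_writtenInExtChartAt {Φ : M → N} {x : M} (hΦ : ContinuousAt Φ x) :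
    (extChartAt (𝓡 n) (Φ x)).symm ∘ writtenInExtChartAt (𝓡 n) (𝓡 n) x Φ
      =ᶠ[nhds (extChartAt (𝓡 n) x x)] Φ ∘ (extChartAt (𝓡 n) x).symm := by
  have cont : ContinuousAt (Φ ∘ (extChartAt (𝓡 n) x).symm) (extChartAt (𝓡 n) x x) :=
    ContinuousAt.comp (by rwa [extChartAt_to_inv]) (continuousAt_extChartAt_symm x)
  have source : (extChartAt (𝓡 n) (Φ x)).source
      ∈ nhds ((Φ ∘ (extChartAt (𝓡 n) x).symm) (extChartAt (𝓡 n) x x)) := by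
    rw [Function.comp_apply, extChartAt_to_inv]
    exact extChartAt_source_mem_nhds (Φ x)
  filter_upwards [cont.preimage_mem_nhds source] with z hz
    using (extChartAt (𝓡 n) (Φ x)).left_inv hz

theorem eventually_mdifferentiableAt_extChartAt_symm [IsManifold (𝓡 n) ∞ M] (x : M) :
    ∀ᶠ z in nhds (extChartAt (𝓡 n) x x),
      MDifferentiableAt (𝓡 n) (𝓡 n) (extChartAt (𝓡 n) x).symm z := by
  filter_upwards [extChartAt_target_mem_nhds x] with z hz
  exact ((contMDiffOn_extChartAt_symm (n := ∞) x).contMDiffAt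
    ((isOpen_extChartAt_target x).mem_nhds hz)).mdifferentiableAt (by simp)

theorem modelDeriv_extChartAt_symm_comp_fderiv [IsManifold (𝓡 n) ∞ M] [IsManifold (𝓡 n) ∞ N]
    {Φ : M → N} (hΦ : IsLocalDiffeomorph (𝓡 n) (𝓡 n) ∞ Φ) (x : M) :
    ∀ᶠ z in nhds (extChartAt (𝓡 n) x x),
      modelDeriv (extChartAt (𝓡 n) (Φ x)).symm (writtenInExtChartAt (𝓡 n) (𝓡 n) x Φ z)
          ∘L fderiv ℝ (writtenInExtChartAt (𝓡 n) (𝓡 n) x Φ) z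
        = modelDeriv Φ ((extChartAt (𝓡 n) x).symm z)
          ∘L modelDeriv (extChartAt (𝓡 n) x).symm z := by
  have hF := isLocalDiffeoAt_writtenInExtChartAt (hΦ x)
  have symmN : ∀ᶠ w in nhds (writtenInExtChartAt (𝓡 n) (𝓡 n) x Φ (extChartAt (𝓡 n) x x)),
      MDifferentiableAt (𝓡 n) (𝓡 n) (extChartAt (𝓡 n) (Φ x)).symm w := by
    simp only [writtenInExtChartAt, Function.comp_apply, extChartAt_to_inv]
    exact eventually_mdifferentiableAt_extChartAt_symm (Φ x)
  filter_upwards [(extChartAt_symm_comp_writtenInExtChartAt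
      (hΦ.contMDiff.continuous.continuousAt (x := x))).eventuallyEq_nhds,
    eventually_mdifferentiableAt_extChartAt_symm x, hF.contDiffAt.continuousAt.eventually symmN,
    hF.eventually] with z charts hM hN hFz
  rw [← modelDeriv_eq_fderiv, ← modelDeriv_comp hN hFz.differentiableAt.mdifferentiableAt,
    modelDeriv_congr charts, modelDeriv_comp (hΦ.mdifferentiable (by simp) _) hM]

end Charts

section MetricInChart

variable {n : ℕ}
  {M : Type*} [TopologicalSpace M] [ChartedSpace (Model n) M] [IsManifold (𝓡 n) ∞ M]

/-- The bilinear form of a metric at a point, on the model space (see `modelDeriv`). -/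
def PseudoRiemannianMetric.form (g : PseudoRiemannianMetric n M) (x : M) :
    Model n →L[ℝ] Model n →L[ℝ] ℝ :=
  g.val x

theorem isInvertible_of_nondegenerate {b : Model n →L[ℝ] Model n →L[ℝ] ℝ}
    (nondegenerate : ∀ u, (∀ v, b u v = 0) → u = 0) : b.IsInvertible := by
  have inj : Function.Injective b.toLinearMap :=
    (injective_iff_map_eq_zero _).2 fun u hu => nondegenerate u fun v => by
      simpa using congrArg (fun l : Model n →L[ℝ] ℝ => l v) hu
  have dim : Module.finrank ℝ (Model n) = Module.finrank ℝ (Model n →L[ℝ] ℝ) := by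
    rw [(LinearMap.toContinuousLinearMap (𝕜 := ℝ) (E := Model n) (F' := ℝ)).symm.finrank_eq,
      Module.finrank_linearMap, Module.finrank_self, mul_one]
  exact ⟨(LinearEquiv.ofInjectiveOfFinrankEq b.toLinearMap inj dim).toContinuousLinearEquiv, rfl⟩

theorem PseudoRiemannianMetric.isInvertible_form (g : PseudoRiemannianMetric n M) (x : M) :
    (g.form x).IsInvertible :=
  isInvertible_of_nondegenerate (g.nondegenerate x)

theorem PseudoRiemannianMetric.inChart_apply (g : PseudoRiemannianMetric n M) (x : M)
    (z u v : Model n) : g.inChart x z u v = g.form ((extChartAt (𝓡 n) x).symm z)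
      (modelDeriv (extChartAt (𝓡 n) x).symm z u) (modelDeriv (extChartAt (𝓡 n) x).symm z v) :=
  rfl

theorem isInvertible_modelDeriv_extChartAt_symm (x : M) {z : Model n}
    (hz : z ∈ (extChartAt (𝓡 n) x).target) :
    (modelDeriv (n := n) (extChartAt (𝓡 n) x).symm z).IsInvertible := by
  have invertible := isInvertible_mfderivWithin_extChartAt_symm hz
  rwa [ModelWithCorners.range_eq_univ, mfderivWithin_univ] at invertible

theorem contMDiffAt_modelDeriv_extChartAt_symm (x : M) {z : Model n}
    (hz : z ∈ (extChartAt (𝓡 n) x).target) (u : Model n) :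
    ContMDiffAt (𝓡 n) ((𝓡 n).prod 𝓘(ℝ, Model n)) ∞
      (fun w => Bundle.TotalSpace.mk' (Model n) (E := fun x : M => TangentSpace (𝓡 n) x)
        ((extChartAt (𝓡 n) x).symm w) (modelDeriv (extChartAt (𝓡 n) x).symm w u)) z := by
  have target := (isOpen_extChartAt_target (I := 𝓡 n) x).mem_nhds hz
  have tangentMap :=
    (contMDiffOn_extChartAt_symm (I := 𝓡 n) (n := ∞) x).contMDiffOn_tangentMapWithin
      (m := ∞) (by simp) (isOpen_extChartAt_target x).uniqueMDiffOn
  have const : ContMDiffAt (𝓡 n) ((𝓡 n).prod 𝓘(ℝ, Model n)) ∞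
      (fun w => Bundle.TotalSpace.mk' (Model n) (E := fun w : Model n => TangentSpace (𝓡 n) w)
        w u) z := contMDiffAt_vectorSpace_iff_contDiffAt.2 contDiffAt_const
  have fiber : Bundle.TotalSpace.proj ⁻¹' (extChartAt (𝓡 n) x).target
      ∈ nhds (⟨z, u⟩ : TangentBundle (𝓡 n) (Model n)) :=
    (FiberBundle.continuous_proj (Model n)
      (fun w : Model n => TangentSpace (𝓡 n) w)).continuousAt.preimage_mem_nhds target
  refine ((tangentMap.contMDiffAt fiber).comp z const).congr_of_eventuallyEq ?_
  filter_upwards [target] with w hw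
  simp only [Function.comp_apply, tangentMapWithin, Bundle.TotalSpace.mk']
  rw [mfderivWithin_of_isOpen (isOpen_extChartAt_target x) hw]
  rfl

theorem PseudoRiemannianMetric.contDiffAt_inChart (g : PseudoRiemannianMetric n M) (x : M)
    {z : Model n} (hz : z ∈ (extChartAt (𝓡 n) x).target) : ContDiffAt ℝ ∞ (g.inChart x) z := by
  refine contDiffAt_bilin_apply.2 fun u v => ?_
  have metric := (g.contMDiff ((extChartAt (𝓡 n) x).symm z)).comp z
    ((contMDiffOn_extChartAt_symm (n := ∞) x).contMDiffAt
      ((isOpen_extChartAt_target x).mem_nhds hz))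
  have smooth := ContMDiffAt.clm_bundle_apply₂ (F₁ := Model n) (F₂ := Model n) (F₃ := ℝ)
    (E₃ := Bundle.Trivial M ℝ) metric (contMDiffAt_modelDeriv_extChartAt_symm x hz u)
    (contMDiffAt_modelDeriv_extChartAt_symm x hz v)
  simp only [Bundle.contMDiffAt_totalSpace] at smooth
  exact smooth.2.contDiffAt

theorem PseudoRiemannianMetric.isMetricAt_inChart (g : PseudoRiemannianMetric n M) (x : M) :
    IsMetricAt (g.inChart x) (extChartAt (𝓡 n) x x) where
  contDiffAt := (g.contDiffAt_inChart x (mem_extChartAt_target x)).of_le (by norm_cast)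
  symm := .of_forall fun _ _ _ => g.symm _ _ _
  isInvertible := isInvertible_bilinearComp (g.isInvertible_form _)
    (isInvertible_modelDeriv_extChartAt_symm x (mem_extChartAt_target x))

end MetricInChart

section ConformalMaps

variable {n : ℕ}
  {M : Type*} [TopologicalSpace M] [ChartedSpace (Model n) M] [IsManifold (𝓡 n) ∞ M]
  {N : Type*} [TopologicalSpace N] [ChartedSpace (Model n) N] [IsManifold (𝓡 n) ∞ N]
  {P : Type*} [TopologicalSpace P] [ChartedSpace (Model n) P] [IsManifold (𝓡 n) ∞ P]
  {gM : PseudoRiemannianMetric n M} {gN : PseudoRiemannianMetric n N}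
  {gP : PseudoRiemannianMetric n P} {Φ : M → N} {Ψ : N → P} {Ω : M → ℝ} {lam : ℂ}

theorem isConformalFactor_iff : IsConformalFactor gM gN Φ Ω ↔ (∀ x, 0 < Ω x) ∧
    ∀ x u v, gN.form (Φ x) (modelDeriv Φ x u) (modelDeriv Φ x v) = Ω x ^ 2 * gM.form x u v :=
  Iff.rfl

theorem isConformalFactor_id (g : PseudoRiemannianMetric n M) :
    IsConformalFactor g g id (fun _ => 1) := by
  refine isConformalFactor_iff.2 ⟨fun _ => one_pos, fun x u v => ?_⟩
  simp [modelDeriv_id]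

theorem IsConformalFactor.comp {Ω' : N → ℝ} (hΨ : IsConformalFactor gN gP Ψ Ω')
    (hΦ : IsConformalFactor gM gN Φ Ω) (dΨ : MDifferentiable (𝓡 n) (𝓡 n) Ψ)
    (dΦ : MDifferentiable (𝓡 n) (𝓡 n) Φ) :
    IsConformalFactor gM gP (Ψ ∘ Φ) (fun x => Ω' (Φ x) * Ω x) := by
  rw [isConformalFactor_iff] at *
  refine ⟨fun x => mul_pos (hΨ.1 _) (hΦ.1 _), fun x u v => ?_⟩
  rw [modelDeriv_comp (dΨ _) (dΦ _), ContinuousLinearMap.comp_apply,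
    ContinuousLinearMap.comp_apply, Function.comp_apply, hΨ.2, hΦ.2]
  ring

theorem IsConformalFactor.symm (Θ : M ≃ₘ⟮𝓡 n, 𝓡 n⟯ N) (hΘ : IsConformalFactor gM gN Θ Ω) :
    IsConformalFactor gN gM Θ.symm (fun y => (Ω (Θ.symm y))⁻¹) := by
  rw [isConformalFactor_iff] at *
  refine ⟨fun y => inv_pos.2 (hΘ.1 _), fun y u v => ?_⟩
  have rightInverse (w : Model n) :
      modelDeriv Θ (Θ.symm y) (modelDeriv Θ.symm y w) = w := by
    rw [← ContinuousLinearMap.comp_apply, ← modelDeriv_comp (Θ.mdifferentiable (by simp) _)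
      (Θ.symm.mdifferentiable (by simp) _), show (Θ ∘ Θ.symm : N → N) = id from
        funext Θ.apply_symm_apply, modelDeriv_id, ContinuousLinearMap.id_apply]
  have conformal := hΘ.2 (Θ.symm y) (modelDeriv Θ.symm y u) (modelDeriv Θ.symm y v)
  rw [rightInverse, rightInverse, Θ.apply_symm_apply] at conformal
  rw [conformal, ← mul_assoc, ← mul_pow, inv_mul_cancel₀ (hΘ.1 _).ne', one_pow, one_mul]

namespace IsConformalMap

theorem mdifferentiable (hΦ : IsConformalMap gM gN Φ) : MDifferentiable (𝓡 n) (𝓡 n) Φ :=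
  hΦ.isLocalDiffeomorph.mdifferentiable (by simp)

protected theorem id (g : PseudoRiemannianMetric n M) : IsConformalMap g g id :=
  ⟨(Diffeomorph.refl (𝓡 n) M ∞).isLocalDiffeomorph, _, isConformalFactor_id g⟩

theorem comp (hΨ : IsConformalMap gN gP Ψ) (hΦ : IsConformalMap gM gN Φ) :
    IsConformalMap gM gP (Ψ ∘ Φ) :=
  ⟨fun x => .comp (hf := hΦ.isLocalDiffeomorph x) (hg := hΨ.isLocalDiffeomorph (Φ x)), _,
    hΨ.isConformalFactor.comp hΦ.isConformalFactor hΨ.mdifferentiable hΦ.mdifferentiable⟩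

theorem symm {Θ : M ≃ₘ⟮𝓡 n, 𝓡 n⟯ N} (hΘ : IsConformalMap gM gN Θ) :
    IsConformalMap gN gM Θ.symm :=
  ⟨Θ.symm.isLocalDiffeomorph, _, hΘ.isConformalFactor.symm Θ⟩

theorem factor_pos (hΦ : IsConformalMap gM gN Φ) (x : M) : 0 < hΦ.factor x :=
  hΦ.isConformalFactor.1 x

theorem pullbackMetric_inChart (hΦ : IsConformalMap gM gN Φ) (x : M) :
    pullbackMetric (gN.inChart (Φ x)) (writtenInExtChartAt (𝓡 n) (𝓡 n) x Φ)
      =ᶠ[nhds (extChartAt (𝓡 n) x x)]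
        fun z => hΦ.factor ((extChartAt (𝓡 n) x).symm z) ^ 2 • gM.inChart x z := by
  filter_upwards [modelDeriv_extChartAt_symm_comp_fderiv hΦ.isLocalDiffeomorph x,
    extChartAt_symm_comp_writtenInExtChartAt (n := n) (hΦ.mdifferentiable x).continuousAt]
    with z deriv charts
  simp only [Function.comp_apply] at charts
  ext u v
  have push (w : Model n) := DFunLike.congr_fun deriv w
  simp only [ContinuousLinearMap.comp_apply] at push
  rw [pullbackMetric_apply, gN.inChart_apply, push, push, charts,
    (isConformalFactor_iff.1 hΦ.isConformalFactor).2, ← gM.inChart_apply]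
  rfl

variable [NeZero n]

theorem factor_id (g : PseudoRiemannianMetric n M) (x : M) :
    (IsConformalMap.id g).factor x = 1 :=
  congrFun ((IsConformalMap.id g).isConformalFactor.unique (isConformalFactor_id g)) x

theorem factor_comp (hΨ : IsConformalMap gN gP Ψ) (hΦ : IsConformalMap gM gN Φ) (x : M) :
    (hΨ.comp hΦ).factor x = hΨ.factor (Φ x) * hΦ.factor x :=
  congrFun ((hΨ.comp hΦ).isConformalFactor.unique (hΨ.isConformalFactor.comp
    hΦ.isConformalFactor hΨ.mdifferentiable hΦ.mdifferentiable)) x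

theorem contDiffAt_factor_comp_extChartAt_symm (hΦ : IsConformalMap gM gN Φ)
    (x : M) : ContDiffAt ℝ ∞ (hΦ.factor ∘ (extChartAt (𝓡 n) x).symm) (extChartAt (𝓡 n) x x) :=
  (((hΦ.isConformalFactor.contMDiff hΦ.isLocalDiffeomorph.contMDiff).comp_contMDiffOn
    (contMDiffOn_extChartAt_symm x)).contMDiffAt
      (extChartAt_target_mem_nhds x)).contDiffAt

end IsConformalMap

theorem yamabe_apply (g : PseudoRiemannianMetric n M) (f : smoothFunctions n M) (x : M) :
    yamabe g f x = localYamabe (g.inChart x) ((f : M → ℂ) ∘ (extChartAt (𝓡 n) x).symm)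
      (extChartAt (𝓡 n) x x) := by
  simp only [localYamabe, Function.comp_apply, extChartAt_to_inv]
  rfl

variable [NeZero n]

theorem twistedPullback_apply (hΦ : IsConformalMap gM gN Φ) (f : smoothFunctions n N) (x : M) :
    (twistedPullback hΦ lam f : M → ℂ) x = (hΦ.factor x : ℂ) ^ lam * (f : N → ℂ) (Φ x) :=
  rfl

theorem twistedPullback_id (g : PseudoRiemannianMetric n M) :
    twistedPullback (IsConformalMap.id g) lam = LinearMap.id := by
  ext f x
  rw [twistedPullback_apply, IsConformalMap.factor_id, Complex.ofReal_one, Complex.one_cpow,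
    one_mul, LinearMap.id_apply, id]

theorem twistedPullback_comp (hΨ : IsConformalMap gN gP Ψ) (hΦ : IsConformalMap gM gN Φ) :
    twistedPullback (hΨ.comp hΦ) lam = twistedPullback hΦ lam ∘ₗ twistedPullback hΨ lam := by
  ext f x
  rw [LinearMap.comp_apply, twistedPullback_apply, twistedPullback_apply, twistedPullback_apply,
    hΨ.factor_comp hΦ, Complex.ofReal_mul, Complex.mul_cpow_ofReal_nonneg (hΨ.factor_pos _).le
      (hΦ.factor_pos x).le, mul_comm ((hΨ.factor _ : ℂ) ^ lam), mul_assoc, Function.comp_apply]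

theorem twistedPullback_comp_eq_id {Φ' : N → M} (hΦ : IsConformalMap gM gN Φ)
    (hΦ' : IsConformalMap gN gM Φ') (rightInverse : Φ ∘ Φ' = id) :
    twistedPullback hΦ' lam ∘ₗ twistedPullback hΦ lam = LinearMap.id := by
  rw [← twistedPullback_comp]
  simp only [rightInverse, twistedPullback_id]

section Action

variable {G' G : Type*} [Group G'] [Group G] [MulAction G' M] [MulAction G N]

theorem IsConformalAction.factor_equivariant (hM : IsConformalAction G' gM)
    (hN : IsConformalAction G gN) (hΦ : IsConformalMap gM gN Φ) {h : G'} {k : G}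
    (equivariant : ∀ x, k • Φ x = Φ (h • x)) (x : M) :
    hΦ.factor (h • x) * hM.factor h x = hΦ.factor x * hN.factor k (Φ x) := by
  have square : (fun y => k • y) ∘ Φ = Φ ∘ fun x => h • x := funext equivariant
  calc hΦ.factor (h • x) * (hM h).factor x
      = (hΦ.comp (hM h)).factor x := (hΦ.factor_comp (hM h) x).symm
    _ = ((hN k).comp hΦ).factor x := by simp only [square]
    _ = hΦ.factor x * (hN k).factor (Φ x) := ((hN k).factor_comp hΦ x).trans (mul_comm _ _)

theorem IsConformalAction.twistedPullback_comp_varpi (hM : IsConformalAction G' gM)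
    (hN : IsConformalAction G gN) (hΦ : IsConformalMap gM gN Φ) {h : G'} {k : G}
    (equivariant : ∀ x, k • Φ x = Φ (h • x)) :
    twistedPullback hΦ lam ∘ₗ varpi hN lam k = varpi hM lam h ∘ₗ twistedPullback hΦ lam := by
  have square : (fun y => k⁻¹ • y) ∘ Φ = Φ ∘ fun x => h⁻¹ • x := funext fun x => by
    rw [Function.comp_apply, inv_smul_eq_iff, Function.comp_apply, equivariant, smul_inv_smul]
  calc twistedPullback hΦ lam ∘ₗ twistedPullback (hN k⁻¹) lam
      = twistedPullback ((hN k⁻¹).comp hΦ) lam := (twistedPullback_comp ..).symm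
    _ = twistedPullback (hΦ.comp (hM h⁻¹)) lam := by simp only [square]
    _ = twistedPullback (hM h⁻¹) lam ∘ₗ twistedPullback hΦ lam := twistedPullback_comp ..

end Action

theorem yamabe_twistedPullback (hn : n ≠ 1) (hΦ : IsConformalMap gM gN Φ)
    (f : smoothFunctions n N) (x : M) :
    yamabe gM (twistedPullback hΦ (((n : ℂ) - 2) / 2) f) x
      = (hΦ.factor x : ℂ) ^ (((n : ℂ) - 2) / 2) * (hΦ.factor x : ℂ) ^ 2 * yamabe gN f (Φ x) := by
  have center : writtenInExtChartAt (𝓡 n) (𝓡 n) x Φ (extChartAt (𝓡 n) x x)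
      = extChartAt (𝓡 n) (Φ x) (Φ x) := by
    simp only [writtenInExtChartAt, Function.comp_apply, extChartAt_to_inv]
  have twisted : (twistedPullback hΦ (((n : ℂ) - 2) / 2) f : M → ℂ) ∘ (extChartAt (𝓡 n) x).symm
      =ᶠ[nhds (extChartAt (𝓡 n) x x)]
        fun z => ((hΦ.factor ∘ (extChartAt (𝓡 n) x).symm) z : ℂ) ^ (((n : ℂ) - 2) / 2)
          * ((f : N → ℂ) ∘ (extChartAt (𝓡 n) (Φ x)).symm)
            (writtenInExtChartAt (𝓡 n) (𝓡 n) x Φ z) := by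
    filter_upwards [extChartAt_symm_comp_writtenInExtChartAt (n := n)
      (hΦ.mdifferentiable x).continuousAt] with z charts
    simp only [Function.comp_apply] at charts ⊢
    rw [charts, twistedPullback_apply]
  rw [yamabe_apply, yamabe_apply, localYamabe_congr _ twisted, localYamabe_covariant
    (by exact_mod_cast hn) (gM.isMetricAt_inChart x) (center ▸ gN.isMetricAt_inChart (Φ x))
    (isLocalDiffeoAt_writtenInExtChartAt (hΦ.isLocalDiffeomorph x))
    ((hΦ.contDiffAt_factor_comp_extChartAt_symm x).of_le (by norm_cast)) (hΦ.factor_pos _)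
    (hΦ.pullbackMetric_inChart x) (center ▸ (contDiffAt_inChart f.2 (Φ x)).of_le (by norm_cast)),
    center, Function.comp_apply, extChartAt_to_inv]

theorem mapsTo_twistedPullback_yamabeKer (hn : n ≠ 1) (hΦ : IsConformalMap gM gN Φ) :
    Set.MapsTo (twistedPullback hΦ (((n : ℂ) - 2) / 2)) (yamabeKer gN) (yamabeKer gM) := by
  intro f hf
  have harmonic : yamabe gN f = 0 := hf
  refine LinearMap.mem_ker.2 (funext fun x => ?_)
  rw [yamabe_twistedPullback hn, harmonic, Pi.zero_apply, mul_zero, Pi.zero_apply]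

end ConformalMaps

end ConformalGeometry

end

open ConformalGeometry in
theorem proposition2p6 {n : ℕ} [n.AtLeastTwo]
    {M : Type*} [TopologicalSpace M] [ChartedSpace (Model n) M] [IsManifold (𝓡 n) ∞ M]
    {N : Type*} [TopologicalSpace N] [ChartedSpace (Model n) N] [IsManifold (𝓡 n) ∞ N]
    (gM : PseudoRiemannianMetric n M) (gN : PseudoRiemannianMetric n N)
    (Φ : M → N) (hΦ : IsConformalMap gM gN Φ)
    {G' G : Type*} [Group G'] [Group G] [MulAction G' M] [MulAction G N]
    (hM : IsConformalAction G' gM) (hN : IsConformalAction G gN)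
    (i : G' →* G) (hi : ∀ (h : G') (x : M), i h • Φ x = Φ (h • x)) :
    -- compatibility of the conformal factors
    (∀ (h : G') (x : M),
      hΦ.factor (h • x) * hM.factor h x = hΦ.factor x * hN.factor (i h) (Φ x)) ∧
    -- the twisted pull-backs intertwine the representations
    (∀ (lam : ℂ) (h : G'),
      twistedPullback hΦ lam ∘ₗ varpi hN lam (i h) = varpi hM lam h ∘ₗ twistedPullback hΦ lam) ∧
    -- the critical twisted pull-back maps kernel to kernel, compatibly with the actions on kernels
    (Set.MapsTo (twistedPullback hΦ (((n : ℂ) - 2) / 2)) (yamabeKer gN) (yamabeKer gM) ∧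
      (∀ k : G, Set.MapsTo (varpi hN (((n : ℂ) - 2) / 2) k) (yamabeKer gN) (yamabeKer gN)) ∧
      (∀ h : G', Set.MapsTo (varpi hM (((n : ℂ) - 2) / 2) h) (yamabeKer gM) (yamabeKer gM)) ∧
      ∀ (h : G'), ∀ f ∈ yamabeKer gN,
        twistedPullback hΦ (((n : ℂ) - 2) / 2) (varpi hN (((n : ℂ) - 2) / 2) (i h) f)
          = varpi hM (((n : ℂ) - 2) / 2) h (twistedPullback hΦ (((n : ℂ) - 2) / 2) f)) ∧
    -- the case of a diffeomorphism
    (∀ Ψ : M ≃ₘ⟮𝓡 n, 𝓡 n⟯ N, (∀ x, Ψ x = Φ x) →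
      ∃ hΨ : IsConformalMap gN gM Ψ.symm,
        (∀ lam : ℂ,
          twistedPullback hΨ lam ∘ₗ twistedPullback hΦ lam = LinearMap.id ∧
          twistedPullback hΦ lam ∘ₗ twistedPullback hΨ lam = LinearMap.id) ∧
        Set.BijOn (twistedPullback hΦ (((n : ℂ) - 2) / 2)) (yamabeKer gN) (yamabeKer gM) ∧
        Set.BijOn (twistedPullback hΨ (((n : ℂ) - 2) / 2)) (yamabeKer gM) (yamabeKer gN) ∧
        Set.InvOn (twistedPullback hΨ (((n : ℂ) - 2) / 2)) (twistedPullback hΦ (((n : ℂ) - 2) / 2))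
          (yamabeKer gN) (yamabeKer gM)) := by
  have hn : n ≠ 1 := Nat.AtLeastTwo.ne_one
  have intertwining (lam : ℂ) (h : G') : twistedPullback hΦ lam ∘ₗ varpi hN lam (i h)
      = varpi hM lam h ∘ₗ twistedPullback hΦ lam :=
    hM.twistedPullback_comp_varpi hN hΦ (hi h)
  refine ⟨fun h x => hM.factor_equivariant hN hΦ (hi h) x, intertwining,
    ⟨mapsTo_twistedPullback_yamabeKer hn hΦ,
      fun k => mapsTo_twistedPullback_yamabeKer hn (hN k⁻¹),
      fun h => mapsTo_twistedPullback_yamabeKer hn (hM h⁻¹),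
      fun h f _ => LinearMap.congr_fun (intertwining _ h) f⟩, fun Ψ hΨ => ?_⟩
  obtain rfl : ⇑Ψ = Φ := funext hΨ
  have left (lam : ℂ) : twistedPullback hΦ.symm lam ∘ₗ twistedPullback hΦ lam = LinearMap.id :=
    twistedPullback_comp_eq_id hΦ hΦ.symm (funext Ψ.apply_symm_apply)
  have right (lam : ℂ) : twistedPullback hΦ lam ∘ₗ twistedPullback hΦ.symm lam = LinearMap.id :=
    twistedPullback_comp_eq_id hΦ.symm hΦ (funext Ψ.symm_apply_apply)
  have inverse : Set.InvOn (twistedPullback hΦ.symm (((n : ℂ) - 2) / 2))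
      (twistedPullback hΦ (((n : ℂ) - 2) / 2)) (yamabeKer gN) (yamabeKer gM) :=
    ⟨fun f _ => LinearMap.congr_fun (left _) f, fun f _ => LinearMap.congr_fun (right _) f⟩
  have mapsTo := mapsTo_twistedPullback_yamabeKer hn hΦ
  have mapsTo_symm := mapsTo_twistedPullback_yamabeKer hn hΦ.symm
  exact ⟨hΦ.symm, fun lam => ⟨left lam, right lam⟩, inverse.bijOn mapsTo mapsTo_symm,
    inverse.symm.bijOn mapsTo_symm mapsTo, inverse⟩
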